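/- Let $G=(V,E)$ be a finite simple graph drawn in the complex plane: its vertices are distinct points of $\mathbb{C}$, each edge is drawn as the straight line segment between its end points, the relative interiors of different edges are disjoint, and no vertex lies in the relative interior of an edge. Let $(x_{\bar e})_{\bar e\in E}$ be arbitrary real edge weights. A directed edge $e=(t_e,h_e)$ is an edge $\bar e=\{t_e,h_e\}\in E$ with a choice of tail $t_e$ and head $h_e$; its reversal is $-e=(h_e,t_e)$. For directed edges $e,g$ let $$\angle(e,g)=\operatorname{Arg}\Big(\frac{h_g-t_g}{h_e-t_e}\Big)\in(-\pi,\pi]$$ be the turning angle from $e$ to $g$, and let $\Lambda$ be the complex matrix indexed by the directed edges with $$\Lambda_{e,g}=\begin{cases}x_{\bar e}\,e^{\frac i2\angle(e,g)} & \text{if } h_e=t_g \text{ and } g\neq -e,\\ 0 & \text{otherwise.}\end{cases}$$ Call $H\subseteq E$ even if every vertex has even degree in $(V,H)$, and let $$Z=\sum_{H\subseteq E\text{ even}}\ \prod_{\bar e\in H}x_{\bar e}$$ (the empty product is $1$). Then $$\det(\mathrm{Id}-\Lambda)=Z^2,$$ where $\mathrm{Id}$ is the identity matrix. -/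

import Mathlib

namespace KacWard

/-- The map `p` draws the graph `G` in the complex plane: the vertices are distinct points, the edge
`ab` is the straight segment from `p a` to `p b`, no vertex lies in the relative interior of an
edge, and the relative interiors of any two different edges are disjoint. -/
structure IsStraightLineEmbedding {V : Type*} (G : SimpleGraph V) (p : V → ℂ) : Prop where
  injective : Function.Injective p
  vertex_notMem : ∀ a b v : V, G.Adj a b → p v ∉ openSegment ℝ (p a) (p b)
  edges_disjoint : ∀ a b c d : V, G.Adj a b → G.Adj c d → s(a, b) ≠ s(c, d) →
    Disjoint (openSegment ℝ (p a) (p b)) (openSegment ℝ (p c) (p d))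

/-- The turning angle from the directed edge `e` to the directed edge `g`, in `(-π, π]`.
The tail of a directed edge is its `fst` and the head is its `snd`. -/
noncomputable def turningAngle {V : Type*} {G : SimpleGraph V} (p : V → ℂ) (e g : G.Dart) : ℝ :=
  Complex.arg ((p g.snd - p g.fst) / (p e.snd - p e.fst))

/-- The transition matrix on directed edges. Of the weights `x`, only the values on the edges of `G`
are used. -/
noncomputable def transitionMatrix {V : Type*} [DecidableEq V] {G : SimpleGraph V} (p : V → ℂ)
    (x : Sym2 V → ℝ) : Matrix G.Dart G.Dart ℂ :=
  Matrix.of fun e g =>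
    if e.snd = g.fst ∧ g ≠ e.symm then
      (x e.edge : ℂ) * Complex.exp (Complex.I / 2 * (turningAngle p e g : ℂ))
    else 0

/-- A set `H` of edges is even if every vertex is an end point of an even number of edges in `H`. -/
def IsEven {V : Type*} [DecidableEq V] (H : Finset (Sym2 V)) : Prop :=
  ∀ v : V, Even (H.filter fun e => v ∈ e).card

open Classical in
/-- The generating function of the even subgraphs of `G`. -/
noncomputable def evenGeneratingFunction {V : Type*} [Fintype V] [DecidableEq V]
    (G : SimpleGraph V) [DecidableRel G.Adj] (x : Sym2 V → ℝ) : ℝ :=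
  ∑ H ∈ G.edgeFinset.powerset.filter fun H => IsEven H, ∏ e ∈ H, x e

end KacWard

/-!
The Kac–Ward formula is proved here without Pfaffians and without a winding number argument; the
planarity of the drawing enters only through the vertical order of edges.

After a rotation the vertices have distinct abscissas. Every directed edge then points to the right
or to the left, and its direction has a preferred angle, in `(-π / 2, π / 2)` or in
`(π / 2, 3 * π / 2)`. Conjugation with the square roots of these directions (`halfPhase`) makes the
transition matrix real, up to the weights: its entry at `f`, `g` becomes `ε(f) x_f S(-f, g)`, where
`ε(f) = ±1` tells left from right and `S` is the antisymmetric matrix of signs that compares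
directed edges with the same tail in the order of their angles (`signMatrix`,
`exp_half_turningAngle`).

The inverse of `1 - signMatrix` is then guessed. For an edge set `H` whose degrees become even when
a half-edge at the tail of `d` and one at the tail of `g` are added, let

  `s(H; d, g) = τ(d, g) c_d(H) c_g(H)`,

where `τ` is the sign in a total order of the directed edges (`dartSign`), and `c_d(H)` is the
parity of the crossings of `H` with a curve that leaves the tail of `d` just clockwise of `d`, turns
clockwise to the downward direction and then descends to infinity (`totalCrossSign`). With
`B(d, g)` the sum of `s(H; d, g) x^H` over such `H` avoiding both edges, and `Z` the generating
function of the even sets, one has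
`B(d, g) = Z S(d, g) - ∑ a, B(d, -a) ε(a) x_a S(a, g)` (`oddSum_eq`). For a fixed edge set this
splits into two facts. One is local: at a vertex, the sum is the expansion of the Pfaffian of the
all-ones antisymmetric matrix along a row (`sum_alternating_of_odd`). The other says how `s`
changes when the half-edge is moved along an edge of `H` (`edgeSign_mul_configSign_erase`), and it
reduces to single pairs of edges: along one edge, another edge enters or leaves the region
below it only at its own end points, because edges do not cross (`crossSign_edge`).

So the rows of `Z (1 - signMatrix)⁻¹` are known (`greenRow_vecMul`). Its block at `e`, `-e` is `Z'`
times the identity, where `Z'` is `Z` with the weight of `e` set to zero. Comparing determinants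
gives `Z' ^ 2 det(x) = Z ^ 2 det(x')` (`det_mul_evenSum_sq`), where `x'` has the weight of `e` set
to zero, and the formula follows by adding the edges one at a time. The cancellation of `Z'` is
justified by working with weights multiplied by an indeterminate.
-/

namespace KacWard

section

variable {V : Type*} {G : SimpleGraph V} {p : V → ℂ}

/-! ### Signs -/

open Classical in
/-- The sign `-1` if `P` holds, and `1` otherwise. -/
noncomputable def negIf (P : Prop) : ℤ := if P then -1 else 1

theorem negIf_pos {P : Prop} (h : P) : negIf P = -1 := if_pos h

theorem negIf_neg {P : Prop} (h : ¬P) : negIf P = 1 := if_neg h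

theorem negIf_mul_self (P : Prop) : negIf P * negIf P = 1 := by
  by_cases h : P <;> simp [negIf, h]

theorem negIf_not (P : Prop) : negIf (¬P) = -negIf P := by
  by_cases h : P <;> simp [negIf, h]

/-- The sign of `t` minus `s` in a linear order. -/
def orderSign {α : Type*} [LinearOrder α] (s t : α) : ℤ :=
  if s < t then 1 else if t < s then -1 else 0

theorem orderSign_of_lt {α : Type*} [LinearOrder α] {s t : α} (h : s < t) :
    orderSign s t = 1 := if_pos h

theorem orderSign_of_gt {α : Type*} [LinearOrder α] {s t : α} (h : t < s) :
    orderSign s t = -1 := by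
  simp [orderSign, h, h.not_gt]

theorem orderSign_self {α : Type*} [LinearOrder α] (s : α) : orderSign s s = 0 := by
  simp [orderSign]

theorem orderSign_eq_neg_negIf {α : Type*} [LinearOrder α] {s t : α} (h : s ≠ t) :
    orderSign s t = -negIf (s < t) := by
  rcases h.lt_or_gt with h | h
  · rw [orderSign_of_lt h, negIf_pos h]; norm_num
  · rw [orderSign_of_gt h, negIf_neg h.not_gt]

theorem orderSign_eq_negIf_gt {α : Type*} [LinearOrder α] {s t : α} (h : s ≠ t) :
    orderSign s t = negIf (t < s) := by
  rcases h.lt_or_gt with h | h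
  · rw [orderSign_of_lt h, negIf_neg h.not_gt]
  · rw [orderSign_of_gt h, negIf_pos h]

/-- An alternating sum over `A`, in the order of the keys, whose terms change sign at `g`. The
doubling avoids a case distinction on the parity of `A.card`. -/
theorem two_mul_sum_alternating {ι α : Type*} [DecidableEq ι] [LinearOrder α] {k : ι → α}
    (hk : Function.Injective k) (A : Finset ι) (g : ι) :
    2 * ∑ a ∈ A, (∏ b ∈ A, negIf (k b < k a)) * orderSign (k a) (k g) =
      1 + (-1) ^ A.card - 2 * (if g ∈ A then 0 else ∏ b ∈ A, negIf (k b < k g)) := by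
  induction A using Finset.induction_on_max_value k with
  | empty => simp
  | insert m A hm hmax ih =>
    have hlt : ∀ b ∈ A, k b < k m := fun b hb =>
      lt_of_le_of_ne (hmax b hb) fun h => hm (hk h ▸ hb)
    have hprod : ∀ t : ι, k m ≤ k t → ∏ b ∈ A, negIf (k b < k t) = (-1) ^ A.card := by
      intro t ht
      rw [Finset.prod_congr rfl fun b hb => negIf_pos ((hlt b hb).trans_le ht), Finset.prod_const]
    have hsum : ∑ a ∈ A, (∏ b ∈ insert m A, negIf (k b < k a)) * orderSign (k a) (k g) =
        ∑ a ∈ A, (∏ b ∈ A, negIf (k b < k a)) * orderSign (k a) (k g) := by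
      refine Finset.sum_congr rfl fun a ha => ?_
      rw [Finset.prod_insert hm, negIf_neg (hlt a ha).not_gt, one_mul]
    rw [Finset.sum_insert hm, hsum, mul_add, ih, Finset.prod_insert hm, Finset.prod_insert hm,
      negIf_neg (lt_irrefl _), hprod m le_rfl, Finset.card_insert_of_notMem hm, pow_succ]
    rcases lt_trichotomy (k m) (k g) with h | h | h
    · have hgA : g ∉ A := fun hg => (hlt g hg).not_gt h
      have hgm : g ≠ m := fun e => h.ne (by rw [e])
      rw [orderSign_of_lt h, hprod g h.le, negIf_pos h, if_neg hgA,
        if_neg (by simp [hgA, hgm])]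
      ring
    · have hgm : m = g := hk h
      subst hgm
      rw [orderSign_self, if_neg hm, if_pos (by simp), hprod m le_rfl]
      ring
    · have hgm : g ≠ m := fun e => h.ne (by rw [e])
      rw [orderSign_of_gt h, negIf_neg h.not_gt]
      by_cases hgA : g ∈ A
      · rw [if_pos hgA, if_pos (by simp [hgA])]
        ring
      · rw [if_neg hgA, if_neg (by simp [hgA, hgm])]
        ring

/-- The expansion of the Pfaffian of the all-ones antisymmetric matrix along the row `g`: if the
row is new, what remains is the sign of its position, and if it is repeated, the sum cancels. -/
theorem sum_alternating_of_odd {ι α : Type*} [DecidableEq ι] [LinearOrder α] {k : ι → α}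
    (hk : Function.Injective k) {A : Finset ι} (hA : (-1 : ℤ) ^ A.card = -1) (g : ι) :
    ∑ a ∈ A, (∏ b ∈ A, negIf (k b < k a)) * orderSign (k a) (k g) =
      -(if g ∈ A then 0 else ∏ b ∈ A, negIf (k b < k g)) := by
  have := two_mul_sum_alternating hk A g
  rw [hA] at this
  linarith

/-! ### Edges as graphs of affine functions -/

/-- The slope of the line through the points `a` and `b`. -/
noncomputable def lineSlope (p : V → ℂ) (a b : V) : ℝ :=
  ((p b).im - (p a).im) / ((p b).re - (p a).re)

/-- The height at the abscissa `t` of the line through the points `a` and `b`. -/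
noncomputable def lineAt (p : V → ℂ) (a b : V) (t : ℝ) : ℝ :=
  (p a).im + lineSlope p a b * (t - (p a).re)

theorem lineSlope_comm (a b : V) : lineSlope p a b = lineSlope p b a := by
  unfold lineSlope
  rw [← neg_sub (p a).im, ← neg_sub (p a).re, neg_div_neg_eq]

theorem lineAt_left (a b : V) : lineAt p a b (p a).re = (p a).im := by
  simp [lineAt]

theorem lineAt_right {a b : V} (h : (p a).re ≠ (p b).re) : lineAt p a b (p b).re = (p b).im := by
  have : (p b).re - (p a).re ≠ 0 := sub_ne_zero.2 h.symm
  unfold lineAt lineSlope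
  field_simp
  ring

theorem lineAt_eq_of_right {a b : V} (h : (p a).re ≠ (p b).re) (t : ℝ) :
    lineAt p a b t = (p b).im + lineSlope p a b * (t - (p b).re) := by
  rw [← lineAt_right h]
  unfold lineAt
  ring

theorem mem_openSegment_of_lineAt {a b : V} {z : ℂ} (h1 : (p a).re < z.re) (h2 : z.re < (p b).re)
    (hz : z.im = lineAt p a b z.re) : z ∈ openSegment ℝ (p a) (p b) := by
  have hab : 0 < (p b).re - (p a).re := by linarith
  refine ⟨((p b).re - z.re) / ((p b).re - (p a).re), (z.re - (p a).re) / ((p b).re - (p a).re),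
    div_pos (by linarith) hab, div_pos (by linarith) hab, ?_, ?_⟩
  · field_simp
    ring
  · apply Complex.ext
    · simp only [Complex.add_re, Complex.real_smul, Complex.re_ofReal_mul]
      field_simp
      ring
    · simp only [Complex.add_im, Complex.real_smul, Complex.im_ofReal_mul]
      rw [hz]
      unfold lineAt lineSlope
      field_simp
      ring

namespace IsStraightLineEmbedding

variable (hp : IsStraightLineEmbedding G p)
include hp

theorem im_ne_lineAt {a b z : V} (hab : G.Adj a b) (h1 : (p a).re < (p z).re)
    (h2 : (p z).re < (p b).re) : (p z).im ≠ lineAt p a b (p z).re := fun h =>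
  hp.vertex_notMem a b z hab (mem_openSegment_of_lineAt h1 h2 h)

/-- Two different edges do not exchange their vertical order: if they did, they would meet above
some abscissa strictly between `s` and `t`. -/
theorem not_lineAt_exchange {a b c d : V} (hab : G.Adj a b) (hcd : G.Adj c d)
    (hne : s(a, b) ≠ s(c, d)) {s t : ℝ}
    (hs : (p a).re ≤ s ∧ s ≤ (p b).re ∧ (p c).re ≤ s ∧ s ≤ (p d).re)
    (ht : (p a).re ≤ t ∧ t ≤ (p b).re ∧ (p c).re ≤ t ∧ t ≤ (p d).re)
    (h1 : lineAt p a b s < lineAt p c d s) (h2 : lineAt p c d t < lineAt p a b t) : False := by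
  obtain ⟨hs1, hs2, hs3, hs4⟩ := hs
  obtain ⟨ht1, ht2, ht3, ht4⟩ := ht
  set u := lineAt p c d s - lineAt p a b s with hu
  set v := lineAt p a b t - lineAt p c d t with hv
  have hu0 : 0 < u := by linarith
  have hv0 : 0 < v := by linarith
  have huv : 0 < u + v := by linarith
  -- the abscissa at which the difference of the two affine functions vanishes
  set r := (v * s + u * t) / (u + v) with hr
  have hrr : r * (u + v) = v * s + u * t := by rw [hr]; field_simp
  have hst : s ≠ t := by
    rintro rfl
    linarith
  have hlo : ∀ y : ℝ, y ≤ s → y ≤ t → y < r := by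
    intro y hys hyt
    rw [hr, lt_div_iff₀ huv]
    rcases hst.lt_or_gt with h | h
    · nlinarith [mul_le_mul_of_nonneg_left hys hv0.le,
        mul_lt_mul_of_pos_left (lt_of_le_of_lt hys h) hu0]
    · nlinarith [mul_le_mul_of_nonneg_left hyt hu0.le,
        mul_lt_mul_of_pos_left (lt_of_le_of_lt hyt h) hv0]
  have hhi : ∀ y : ℝ, s ≤ y → t ≤ y → r < y := by
    intro y hys hyt
    rw [hr, div_lt_iff₀ huv]
    rcases hst.lt_or_gt with h | h
    · nlinarith [mul_le_mul_of_nonneg_left hyt hu0.le,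
        mul_lt_mul_of_pos_left (lt_of_lt_of_le h hyt) hv0]
    · nlinarith [mul_le_mul_of_nonneg_left hys hv0.le,
        mul_lt_mul_of_pos_left (lt_of_lt_of_le h hys) hu0]
  have heq : lineAt p a b r = lineAt p c d r := by
    have key : (lineAt p a b r - lineAt p c d r) * (u + v) = 0 := by
      have : (lineAt p a b r - lineAt p c d r) * (u + v) =
          v * (lineAt p a b s - lineAt p c d s) + u * (lineAt p a b t - lineAt p c d t) := by
        unfold lineAt
        linear_combination (lineSlope p a b - lineSlope p c d) * hrr
      rw [this, hu, hv]
      ring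
    have := (mul_eq_zero.1 key).resolve_right huv.ne'
    linarith
  have hmem : (⟨r, lineAt p a b r⟩ : ℂ) ∈ openSegment ℝ (p a) (p b) :=
    mem_openSegment_of_lineAt (hlo _ hs1 ht1) (hhi _ hs2 ht2) rfl
  exact Set.disjoint_left.1 (hp.edges_disjoint a b c d hab hcd hne) hmem
    (mem_openSegment_of_lineAt (hlo _ hs3 ht3) (hhi _ hs4 ht4) heq)

end IsStraightLineEmbedding

theorem im_sub_lineAt_left {a b z : V} (h : (p a).re < (p z).re) :
    (p z).im - lineAt p a b (p z).re =
      (lineSlope p a z - lineSlope p a b) * ((p z).re - (p a).re) := by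
  have h1 := lineAt_right (p := p) h.ne
  unfold lineAt at h1 ⊢
  linear_combination -h1

theorem im_sub_lineAt_right {a b z : V} (hab : (p a).re ≠ (p b).re) (h : (p z).re < (p b).re) :
    (p z).im - lineAt p a b (p z).re =
      (lineSlope p a b - lineSlope p z b) * ((p b).re - (p z).re) := by
  have h1 := lineAt_right (p := p) h.ne
  rw [lineAt_eq_of_right hab]
  unfold lineAt at h1
  linear_combination h1

theorem im_lt_lineAt_iff_left {a b z : V} (h : (p a).re < (p z).re) :
    (p z).im < lineAt p a b (p z).re ↔ lineSlope p a z < lineSlope p a b := by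
  have h0 : 0 < (p z).re - (p a).re := sub_pos.2 h
  rw [← sub_neg, im_sub_lineAt_left h, ← sub_neg (a := lineSlope p a z)]
  exact ⟨fun h => by nlinarith, fun h => mul_neg_of_neg_of_pos h h0⟩

theorem lineAt_lt_im_iff_left {a b z : V} (h : (p a).re < (p z).re) :
    lineAt p a b (p z).re < (p z).im ↔ lineSlope p a b < lineSlope p a z := by
  have h0 : 0 < (p z).re - (p a).re := sub_pos.2 h
  rw [← sub_pos, im_sub_lineAt_left h, ← sub_pos (b := lineSlope p a b)]
  exact ⟨fun h => by nlinarith, fun h => mul_pos h h0⟩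

theorem im_lt_lineAt_iff_right {a b z : V} (hab : (p a).re ≠ (p b).re) (h : (p z).re < (p b).re) :
    (p z).im < lineAt p a b (p z).re ↔ lineSlope p a b < lineSlope p z b := by
  have h0 : 0 < (p b).re - (p z).re := sub_pos.2 h
  rw [← sub_neg, im_sub_lineAt_right hab h, ← sub_neg (a := lineSlope p a b)]
  exact ⟨fun h => by nlinarith, fun h => mul_neg_of_neg_of_pos h h0⟩

theorem lineAt_lt_im_iff_right {a b z : V} (hab : (p a).re ≠ (p b).re) (h : (p z).re < (p b).re) :
    lineAt p a b (p z).re < (p z).im ↔ lineSlope p z b < lineSlope p a b := by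
  have h0 : 0 < (p b).re - (p z).re := sub_pos.2 h
  rw [← sub_pos, im_sub_lineAt_right hab h, ← sub_pos (b := lineSlope p z b)]
  exact ⟨fun h => by nlinarith, fun h => mul_pos h h0⟩

/-! ### The order of the directed edges -/

/-- The key by which directed edges are ordered: by the abscissa of the tail, and around one tail
counterclockwise, starting from the downward vertical direction. Around a tail, the right-pointing
directed edges come before the left-pointing ones, and the slope increases within both groups. -/
noncomputable def dartKey (p : V → ℂ) (d : G.Dart) : ℝ ×ₗ ℕ ×ₗ ℝ :=
  toLex ((p d.fst).re,
    toLex (if (p d.snd).re < (p d.fst).re then 1 else 0, lineSlope p d.fst d.snd))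

theorem dartKey_lt_of_re_lt {d g : G.Dart} (h : (p d.fst).re < (p g.fst).re) :
    dartKey p d < dartKey p g :=
  Prod.Lex.toLex_lt_toLex.2 (Or.inl h)

theorem dartKey_lt_of_right_of_left {d g : G.Dart} (h : d.fst = g.fst)
    (hd : (p d.fst).re < (p d.snd).re) (hg : (p g.snd).re < (p g.fst).re) :
    dartKey p d < dartKey p g := by
  refine Prod.Lex.toLex_lt_toLex.2 (Or.inr ⟨by rw [h], Prod.Lex.toLex_lt_toLex.2 (Or.inl ?_)⟩)
  simp [hg, hd.not_gt]

theorem dartKey_lt_iff_of_right {d g : G.Dart} (h : d.fst = g.fst)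
    (hd : (p d.fst).re < (p d.snd).re) (hg : (p g.fst).re < (p g.snd).re) :
    dartKey p d < dartKey p g ↔ lineSlope p d.fst d.snd < lineSlope p g.fst g.snd := by
  unfold dartKey
  rw [Prod.Lex.toLex_lt_toLex, Prod.Lex.toLex_lt_toLex]
  rw [h] at hd
  simp [hg.not_gt, hd.not_gt, h]

theorem dartKey_lt_iff_of_left {d g : G.Dart} (h : d.fst = g.fst)
    (hd : (p d.snd).re < (p d.fst).re) (hg : (p g.snd).re < (p g.fst).re) :
    dartKey p d < dartKey p g ↔ lineSlope p d.fst d.snd < lineSlope p g.fst g.snd := by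
  unfold dartKey
  rw [Prod.Lex.toLex_lt_toLex, Prod.Lex.toLex_lt_toLex]
  rw [h] at hd
  simp [hg, hd, h]

theorem re_fst_ne_re_snd (hX : Function.Injective fun v => (p v).re) (d : G.Dart) :
    (p d.fst).re ≠ (p d.snd).re := fun h => d.adj.ne (hX h)

theorem dartKey_injective (hX : Function.Injective fun v => (p v).re)
    (hp : IsStraightLineEmbedding G p) : Function.Injective (dartKey p : G.Dart → _) := by
  rintro ⟨⟨a, b⟩, hab : G.Adj a b⟩ ⟨⟨a', c⟩, hac : G.Adj a' c⟩ h
  have h0 := toLex.injective h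
  simp only [Prod.mk.injEq] at h0
  obtain rfl : a = a' := hX h0.1
  have h1 := toLex.injective h0.2
  simp only [Prod.mk.injEq] at h1
  obtain ⟨h1, h2⟩ := h1
  have hb : (p a).re ≠ (p b).re := fun h => hab.ne (hX h)
  have hc : (p a).re ≠ (p c).re := fun h => hac.ne (hX h)
  suffices b = c by subst this; rfl
  by_contra hbc
  have hbc' : (p b).re ≠ (p c).re := fun h => hbc (hX h)
  -- a head on the line of the other edge, closer to the common tail, lies inside that edge
  have hright : ∀ {s t : V}, G.Adj a t → (p a).re < (p s).re → (p s).re < (p t).re →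
      lineSlope p a s = lineSlope p a t → False := by
    intro s t hat has hst hsl
    refine hp.im_ne_lineAt hat has hst (sub_eq_zero.1 ?_)
    rw [im_sub_lineAt_left has, hsl, sub_self, zero_mul]
  have hleft : ∀ {s t : V}, G.Adj a t → (p s).re < (p a).re → (p t).re < (p s).re →
      lineSlope p a s = lineSlope p a t → False := by
    intro s t hat has hst hsl
    refine hp.im_ne_lineAt hat.symm hst has (sub_eq_zero.1 ?_)
    rw [im_sub_lineAt_right (hst.trans has).ne has, lineSlope_comm s, lineSlope_comm t, hsl,
      sub_self, zero_mul]
  rcases hb.lt_or_gt with hb | hb <;> rcases hc.lt_or_gt with hc | hc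
  · rcases hbc'.lt_or_gt with h | h
    · exact hright hac hb h h2
    · exact hright hab hc h h2.symm
  · simp [hb.not_gt, hc] at h1
  · simp [hb, hc.not_gt] at h1
  · rcases hbc'.lt_or_gt with h | h
    · exact hleft hab hc h h2.symm
    · exact hleft hac hb h h2

/-- The sign `τ(d, g)` of the pair `d`, `g` in the order of the directed edges. -/
noncomputable def dartSign (p : V → ℂ) (d g : G.Dart) : ℤ := orderSign (dartKey p d) (dartKey p g)

/-! ### Crossing and shadow signs -/

/-- The sign of the crossing of `b` with the curve that starts at the tail of `d`, just clockwise of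
`d`, turns clockwise to the downward direction, and then descends to infinity. It is `-1` if the
curve meets `b` in its descent or while it turns around the tail. So that an edge met in the descent
is counted for only one of its two directions, the first condition requires that `b` points to the
right. -/
noncomputable def crossSign (p : V → ℂ) (d b : G.Dart) : ℤ :=
  negIf (((p b.fst).re < (p d.fst).re ∧ (p d.fst).re < (p b.snd).re ∧
    lineAt p b.fst b.snd (p d.fst).re < (p d.fst).im) ∨
      (b.fst = d.fst ∧ dartKey p b < dartKey p d))

/-- The vertex `z` is the right end of the edge of `a` or lies strictly below that edge. -/
def InShadow (p : V → ℂ) (a : G.Dart) (z : V) : Prop :=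
  ((p a.fst).re < (p a.snd).re ∧ (z = a.snd ∨ (p a.fst).re < (p z).re ∧
      (p z).re < (p a.snd).re ∧ (p z).im < lineAt p a.fst a.snd (p z).re)) ∨
    ((p a.snd).re < (p a.fst).re ∧ (z = a.fst ∨ (p a.snd).re < (p z).re ∧
      (p z).re < (p a.fst).re ∧ (p z).im < lineAt p a.snd a.fst (p z).re))

/-- The sign `q(a, z)`: it is `-1` if `z` is in the shadow of the edge of `a`. -/
noncomputable def shadowSign (p : V → ℂ) (a : G.Dart) (z : V) : ℤ := negIf (InShadow p a z)

theorem shadowSign_symm (a : G.Dart) (z : V) : shadowSign p a.symm z = shadowSign p a z := by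
  unfold shadowSign
  exact congrArg negIf (propext or_comm)

theorem shadowSign_of_right {a : G.Dart} (h : (p a.fst).re < (p a.snd).re) (z : V) :
    shadowSign p a z = negIf (z = a.snd ∨ (p a.fst).re < (p z).re ∧
      (p z).re < (p a.snd).re ∧ (p z).im < lineAt p a.fst a.snd (p z).re) := by
  simp [shadowSign, InShadow, h, h.not_gt]

theorem crossSign_right_right {a r : G.Dart} (ha : (p a.fst).re < (p a.snd).re)
    (hr : (p r.fst).re < (p r.snd).re) :
    crossSign p a r = negIf (((p r.fst).re < (p a.fst).re ∧ (p a.fst).re < (p r.snd).re ∧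
      lineAt p r.fst r.snd (p a.fst).re < (p a.fst).im) ∨
      (r.fst = a.fst ∧ lineSlope p r.fst r.snd < lineSlope p a.fst a.snd)) := by
  refine congrArg negIf (propext (or_congr_right (and_congr_right fun h => ?_)))
  exact dartKey_lt_iff_of_right h hr ha

theorem crossSign_right_left {a r : G.Dart} (ha : (p a.fst).re < (p a.snd).re)
    (hr : (p r.fst).re < (p r.snd).re) : crossSign p a r.symm = 1 := by
  refine negIf_neg ?_
  rintro (⟨h1, h2, -⟩ | ⟨h1, h2⟩)
  · exact (h1.trans h2).not_gt hr
  · exact h2.not_gt (dartKey_lt_of_right_of_left h1.symm ha hr)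

theorem crossSign_left_right {a r : G.Dart} (ha : (p a.fst).re < (p a.snd).re)
    (hr : (p r.fst).re < (p r.snd).re) :
    crossSign p a.symm r = negIf (((p r.fst).re < (p a.snd).re ∧ (p a.snd).re < (p r.snd).re ∧
      lineAt p r.fst r.snd (p a.snd).re < (p a.snd).im) ∨ r.fst = a.snd) := by
  refine congrArg negIf (propext (or_congr_right (and_iff_left_of_imp fun h => ?_)))
  exact dartKey_lt_of_right_of_left h hr ha

theorem crossSign_left_left {a r : G.Dart} (ha : (p a.fst).re < (p a.snd).re)
    (hr : (p r.fst).re < (p r.snd).re) :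
    crossSign p a.symm r.symm =
      negIf (r.snd = a.snd ∧ lineSlope p r.fst r.snd < lineSlope p a.fst a.snd) := by
  refine congrArg negIf (propext ?_)
  have hno : ¬((p r.symm.fst).re < (p a.symm.fst).re ∧ (p a.symm.fst).re < (p r.symm.snd).re ∧
    lineAt p r.symm.fst r.symm.snd (p a.symm.fst).re < (p a.symm.fst).im) := fun h =>
      (h.1.trans h.2.1).not_gt hr
  rw [or_iff_right hno]
  refine and_congr_right fun h => ?_
  rw [dartKey_lt_iff_of_left h hr ha]
  simp only [SimpleGraph.Dart.symm, Prod.fst_swap, Prod.snd_swap]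
  rw [lineSlope_comm r.snd, lineSlope_comm a.snd]

theorem crossSign_self (a : G.Dart) : crossSign p a a = 1 := by
  refine negIf_neg ?_
  rintro (⟨h, -⟩ | ⟨-, h⟩)
  · exact lt_irrefl _ h
  · exact lt_irrefl _ h

theorem crossSign_self_symm (a : G.Dart) : crossSign p a a.symm = 1 := by
  refine negIf_neg ?_
  rintro (⟨-, h, -⟩ | ⟨h, -⟩)
  · exact lt_irrefl _ h
  · exact a.adj.ne h.symm

theorem negIf_congr {P Q : Prop} (h : P ↔ Q) : negIf P = negIf Q := congrArg negIf (propext h)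

/-- Only the parity of the number of exchanges of vertical order matters: going along the edge of
`a` from its tail to its head, the edge of `r` enters or leaves the region below `a` only at its
own end points. -/
theorem crossSign_edge_of_right (hX : Function.Injective fun v => (p v).re)
    (hp : IsStraightLineEmbedding G p) {a r : G.Dart} (ha : (p a.fst).re < (p a.snd).re)
    (hr : (p r.fst).re < (p r.snd).re) (hne : r.edge ≠ a.edge) :
    crossSign p a r * crossSign p a r.symm * (crossSign p a.symm r * crossSign p a.symm r.symm) =
      shadowSign p a r.fst * shadowSign p a r.snd := by
  rw [crossSign_right_right ha hr, crossSign_right_left ha hr, crossSign_left_right ha hr,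
    crossSign_left_left ha hr, shadowSign_of_right ha, shadowSign_of_right ha]
  obtain ⟨⟨v, u⟩, hvu : G.Adj v u⟩ := a
  obtain ⟨⟨c, d⟩, hcd : G.Adj c d⟩ := r
  have hne' : s(c, d) ≠ s(v, u) := hne
  clear hne
  simp only at ha hr ⊢
  have nd := @hp.im_ne_lineAt
  have lvu := lineAt_left (p := p) v u
  have ruv := lineAt_right (p := p) ha.ne
  have lcd := lineAt_left (p := p) c d
  have rcd := lineAt_right (p := p) hr.ne
  have ex {s t : ℝ} := hp.not_lineAt_exchange hcd hvu hne' (s := s) (t := t)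
  have ex' {s t : ℝ} := hp.not_lineAt_exchange hvu hcd hne'.symm (s := s) (t := t)
  have hneX : ∀ {s t : V}, (p s).re < (p t).re → s ≠ t := by
    rintro s t h rfl
    exact lt_irrefl _ h
  rcases lt_trichotomy (p c).re (p v).re with cv | cv | cv
  · have cu := cv.trans ha
    rcases lt_trichotomy (p d).re (p v).re with dv | dv | dv
    · have du := dv.trans ha
      simp [negIf, cv.not_gt, cv, dv.not_gt, du, du.not_gt, (hneX cv), (hneX cu), (hneX du)]
    · obtain rfl := hX dv
      simp [negIf, cv.not_gt, cv, ha.not_gt, hneX ha, (hneX cv), (hneX cu)]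
    · rcases lt_trichotomy (p d).re (p u).re with du | du | du
      · have key : lineAt p c d (p v).re < (p v).im ↔ (p d).im < lineAt p v u (p d).re := by
          constructor
          · intro h
            by_contra h'
            exact ex (s := (p v).re) (t := (p d).re) ⟨by linarith, by linarith, le_rfl, by linarith⟩
              ⟨by linarith, le_rfl, by linarith, by linarith⟩ (by linarith)
              (by rw [rcd]; exact lt_of_le_of_ne (not_lt.1 h') (nd hvu dv du).symm)
          · intro h
            by_contra h'
            exact ex' (s := (p v).re) (t := (p d).re)
              ⟨le_rfl, by linarith, by linarith, by linarith⟩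
              ⟨by linarith, by linarith, by linarith, le_rfl⟩
              (by rw [lvu]; exact lt_of_le_of_ne (not_lt.1 h') (nd hcd cv dv)) (by linarith)
        simp [negIf, cv, cv.not_gt, dv, du, du.not_gt, cu, hneX cv, hneX cu, hneX du, key]
      · obtain rfl := hX du
        have h1 := lineAt_lt_im_iff_right (z := v) hr.ne ha
        have h2 : lineSlope p v d ≠ lineSlope p c d := by
          intro h
          refine nd hcd cv ha (sub_eq_zero.1 ?_)
          rw [im_sub_lineAt_right hr.ne ha, h, sub_self, zero_mul]
        rcases h2.lt_or_gt with h | h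
        · simp [negIf, cv, cv.not_gt, ha, hneX cv, hneX cu, h1, h, h.not_gt]
        · simp [negIf, cv, cv.not_gt, ha, hneX cv, hneX cu, h1, h, h.not_gt]
      · have key : lineAt p c d (p v).re < (p v).im ↔ lineAt p c d (p u).re < (p u).im := by
          constructor
          · intro h
            by_contra h'
            exact ex (s := (p v).re) (t := (p u).re)
              ⟨by linarith, by linarith, le_rfl, by linarith⟩
              ⟨by linarith, by linarith, by linarith, le_rfl⟩ (by linarith)
              (by rw [ruv]; exact lt_of_le_of_ne (not_lt.1 h') (nd hcd cu du))
          · intro h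
            by_contra h'
            exact ex' (s := (p v).re) (t := (p u).re)
              ⟨le_rfl, by linarith, by linarith, by linarith⟩
              ⟨by linarith, le_rfl, by linarith, by linarith⟩
              (by rw [lvu]; exact lt_of_le_of_ne (not_lt.1 h') (nd hcd cv dv)) (by linarith)
        simp only [negIf, cv, cv.not_gt, dv, du, du.not_gt, cu, hneX cv, hneX cu, (hneX du).symm,
          key]
        by_cases h : lineAt p c d (p u).re < (p u).im <;> simp [h]
  · obtain rfl := hX cv
    rcases lt_trichotomy (p d).re (p u).re with du | du | du
    · have h1 := im_lt_lineAt_iff_left (b := u) hr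
      simp [negIf, hneX ha, hneX du, hr, du, h1, du.not_gt]
    · obtain rfl := hX du
      exact absurd rfl hne'
    · have h1 := lineAt_lt_im_iff_left (b := d) ha
      simp only [negIf, hneX ha, (hneX du).symm, hr, du, h1, du.not_gt, ha]
      by_cases h : lineSlope p c d < lineSlope p c u <;> simp [h]
  · rcases lt_trichotomy (p c).re (p u).re with cu | cu | cu
    · rcases lt_trichotomy (p d).re (p u).re with du | du | du
      · have vd := cv.trans hr
        have key : (p c).im < lineAt p v u (p c).re ↔ (p d).im < lineAt p v u (p d).re := by
          constructor
          · intro h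
            by_contra h'
            exact ex (s := (p c).re) (t := (p d).re)
              ⟨le_rfl, by linarith, by linarith, by linarith⟩
              ⟨by linarith, le_rfl, by linarith, by linarith⟩ (by linarith)
              (by rw [rcd]; exact lt_of_le_of_ne (not_lt.1 h') (nd hvu vd du).symm)
          · intro h
            by_contra h'
            exact ex' (s := (p c).re) (t := (p d).re)
              ⟨by linarith, by linarith, le_rfl, by linarith⟩
              ⟨by linarith, by linarith, by linarith, le_rfl⟩
              (by rw [lcd]; exact lt_of_le_of_ne (not_lt.1 h') (nd hvu cv cu).symm)
              (by linarith)
        simp only [negIf, cv, cv.not_gt, vd, du, du.not_gt, cu, (hneX cv).symm, hneX cu, (hneX du),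
          key]
        by_cases h : (p d).im < lineAt p v u (p d).re <;> simp [h]
      · obtain rfl := hX du
        have h1 := im_lt_lineAt_iff_right (z := c) ha.ne hr
        have h2 : lineSlope p c d ≠ lineSlope p v d := by
          intro h
          refine nd hvu cv cu (sub_eq_zero.1 ?_)
          rw [im_sub_lineAt_right ha.ne cu, h, sub_self, zero_mul]
        rcases h2.lt_or_gt with h | h
        · simp [negIf, cv, cv.not_gt, hr, (hneX cv).symm, hneX cu, h1, h, h.not_gt]
        · simp [negIf, cv, cv.not_gt, hr, (hneX cv).symm, hneX cu, h1, h, h.not_gt]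
      · have key : lineAt p c d (p u).re < (p u).im ↔ (p c).im < lineAt p v u (p c).re := by
          constructor
          · intro h
            by_contra h'
            exact ex' (s := (p c).re) (t := (p u).re)
              ⟨by linarith, by linarith, le_rfl, by linarith⟩
              ⟨by linarith, le_rfl, by linarith, by linarith⟩
              (by rw [lcd]; exact lt_of_le_of_ne (not_lt.1 h') (nd hvu cv cu).symm)
              (by linarith)
          · intro h
            by_contra h'
            exact ex (s := (p c).re) (t := (p u).re)
              ⟨le_rfl, by linarith, by linarith, by linarith⟩
              ⟨by linarith, by linarith, by linarith, le_rfl⟩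
              (by linarith)
              (by rw [ruv]; exact lt_of_le_of_ne (not_lt.1 h') (nd hcd cu du))
        simp [negIf, cv, cv.not_gt, cu, du.not_gt, du, (hneX cv).symm, hneX cu, (hneX du).symm, key]
    · obtain rfl := hX cu
      simp [negIf, cv, cv.not_gt, (hneX cv).symm, hr.not_gt, (hneX hr).symm]
    · have vd := cv.trans hr
      have ud := cu.trans hr
      simp [negIf, cv.not_gt, cu.not_gt, (hneX cv).symm, (hneX cu).symm, (hneX ud).symm, ud.not_gt]

theorem crossSign_edge (hX : Function.Injective fun v => (p v).re)
    (hp : IsStraightLineEmbedding G p) {a r : G.Dart} (hne : r.edge ≠ a.edge) :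
    crossSign p a r * crossSign p a r.symm * (crossSign p a.symm r * crossSign p a.symm r.symm) =
      shadowSign p a r.fst * shadowSign p a r.snd := by
  have hmain : ∀ a : G.Dart, (p a.fst).re < (p a.snd).re → ∀ r : G.Dart, r.edge ≠ a.edge →
      crossSign p a r * crossSign p a r.symm *
        (crossSign p a.symm r * crossSign p a.symm r.symm) =
      shadowSign p a r.fst * shadowSign p a r.snd := by
    intro a ha r hne
    rcases (re_fst_ne_re_snd hX r).lt_or_gt with hr | hr
    · exact crossSign_edge_of_right hX hp ha hr hne
    · have := crossSign_edge_of_right hX hp ha (r := r.symm) hr (by simpa using hne)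
      rw [SimpleGraph.Dart.symm_symm] at this
      rw [mul_comm (crossSign p a r), mul_comm (crossSign p a.symm r), this, mul_comm]
      rfl
  rcases (re_fst_ne_re_snd hX a).lt_or_gt with ha | ha
  · exact hmain a ha r hne
  · have := hmain a.symm ha r (by simpa using hne)
    rw [SimpleGraph.Dart.symm_symm, shadowSign_symm, shadowSign_symm] at this
    rw [← this, mul_comm]

/-- Moving the second argument of `τ` along the directed edge `a`. -/
theorem dartSign_symm_mul (hX : Function.Injective fun v => (p v).re)
    (hp : IsStraightLineEmbedding G p) {d a : G.Dart} (hne : a.edge ≠ d.edge) :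
    dartSign p d a.symm * (crossSign p d a * crossSign p d a.symm) * shadowSign p a d.fst =
      dartSign p d a := by
  have hmain : ∀ a : G.Dart, (p a.fst).re < (p a.snd).re → a.edge ≠ d.edge →
      dartSign p d a.symm * (crossSign p d a * crossSign p d a.symm) * shadowSign p a d.fst =
      dartSign p d a := by
    clear! a
    intro a ha hne
    have hda : dartKey p d ≠ dartKey p a := fun h => hne (by rw [dartKey_injective hX hp h])
    have hda' : dartKey p d ≠ dartKey p a.symm := fun h =>
      hne (by rw [dartKey_injective hX hp h, SimpleGraph.Dart.edge_symm])
    rw [shadowSign_of_right ha]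
    unfold dartSign
    rcases lt_trichotomy (p d.fst).re (p a.fst).re with h | h | h
    · have h' := h.trans ha
      have e1 : d.fst ≠ a.fst := fun e => h.ne (by rw [e])
      have e2 : d.fst ≠ a.snd := fun e => h'.ne (by rw [e])
      rw [orderSign_of_lt (dartKey_lt_of_re_lt h), orderSign_of_lt (dartKey_lt_of_re_lt h')]
      simp [crossSign, negIf, h.not_gt, h'.not_gt, e1.symm, e2, e2.symm]
    · have e1 : d.fst = a.fst := hX h
      have h' : (p d.fst).re < (p a.snd).re := by rw [e1]; exact ha
      have e2 : d.fst ≠ a.snd := fun e => h'.ne (by rw [e])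
      rw [orderSign_of_lt (dartKey_lt_of_re_lt h'), orderSign_eq_negIf_gt hda]
      simp [crossSign, negIf, h'.not_gt, e1.symm, e2, e2.symm]
    · have e1 : d.fst ≠ a.fst := fun e => h.ne (by rw [e])
      rcases lt_trichotomy (p d.fst).re (p a.snd).re with h' | h' | h'
      · have e2 : d.fst ≠ a.snd := fun e => h'.ne (by rw [e])
        have hn := hp.im_ne_lineAt a.adj h h'
        rw [orderSign_of_lt (dartKey_lt_of_re_lt h'), orderSign_of_gt (dartKey_lt_of_re_lt h)]
        rcases hn.lt_or_gt with hn | hn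
        · simp [crossSign, negIf, h', h'.not_gt, h, e1.symm, e2, e2.symm, hn, hn.not_gt]
        · simp [crossSign, negIf, h', h'.not_gt, h, e1.symm, e2, e2.symm, hn, hn.not_gt]
      · have e2 : d.fst = a.snd := hX h'
        rw [orderSign_of_gt (dartKey_lt_of_re_lt h), orderSign_eq_negIf_gt hda']
        by_cases hk : dartKey p a.symm < dartKey p d
        · simp [crossSign, negIf, e2, hk, ha.not_gt]
        · simp [crossSign, negIf, e2, hk, ha.not_gt]
      · have e2 : d.fst ≠ a.snd := fun e => h'.ne (by rw [e])
        rw [orderSign_of_gt (dartKey_lt_of_re_lt h), orderSign_of_gt (dartKey_lt_of_re_lt h')]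
        simp [crossSign, negIf, h'.not_gt, h.not_gt, e1.symm, e2, e2.symm]
  rcases (re_fst_ne_re_snd hX a).lt_or_gt with ha | ha
  · exact hmain a ha hne
  · have := hmain a.symm ha (by simpa using hne)
    rw [SimpleGraph.Dart.symm_symm, shadowSign_symm] at this
    rw [← this, mul_comm (crossSign p d a.symm)]
    have h1 : crossSign p d a * crossSign p d a = 1 := negIf_mul_self _
    have h2 : crossSign p d a.symm * crossSign p d a.symm = 1 := negIf_mul_self _
    have h3 : shadowSign p a d.fst * shadowSign p a d.fst = 1 := negIf_mul_self _
    calc _ = dartSign p d a * (crossSign p d a * crossSign p d a) *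
          (crossSign p d a.symm * crossSign p d a.symm) *
          (shadowSign p a d.fst * shadowSign p a d.fst) := by ring
      _ = _ := by rw [h1, h2, h3, mul_one, mul_one, mul_one]

/-- The sign `ε(a)`: it is `-1` on right-pointing directed edges and `1` on left-pointing ones. -/
noncomputable def edgeSign (p : V → ℂ) (a : G.Dart) : ℤ := negIf ((p a.fst).re < (p a.snd).re)

theorem edgeSign_symm (hX : Function.Injective fun v => (p v).re) (a : G.Dart) :
    edgeSign p a.symm = -edgeSign p a := by
  have h : (p a.symm.fst).re < (p a.symm.snd).re ↔ ¬(p a.fst).re < (p a.snd).re :=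
    ⟨fun h => h.not_gt, fun h => lt_of_le_of_ne (not_lt.1 h) (re_fst_ne_re_snd hX a).symm⟩
  rw [edgeSign, negIf_congr h, negIf_not, edgeSign]

theorem edgeSign_mul_self (a : G.Dart) : edgeSign p a * edgeSign p a = 1 := negIf_mul_self _

theorem shadowSign_fst (hX : Function.Injective fun v => (p v).re) (a : G.Dart) :
    shadowSign p a a.fst = -edgeSign p a := by
  rcases (re_fst_ne_re_snd hX a).lt_or_gt with h | h
  · simp [shadowSign, InShadow, edgeSign, negIf, h, h.not_gt, a.adj.ne]
  · simp [shadowSign, InShadow, edgeSign, negIf, h, h.not_gt]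

theorem shadowSign_snd (hX : Function.Injective fun v => (p v).re) (a : G.Dart) :
    shadowSign p a a.snd = edgeSign p a := by
  have := shadowSign_fst hX a.symm
  rw [shadowSign_symm, edgeSign_symm hX, neg_neg] at this
  exact this

theorem dartSign_symm_right (hX : Function.Injective fun v => (p v).re) (d : G.Dart) :
    dartSign p d d.symm = -edgeSign p d := by
  unfold dartSign edgeSign
  rcases (re_fst_ne_re_snd hX d).lt_or_gt with h | h
  · rw [orderSign_of_lt (dartKey_lt_of_re_lt h), negIf_pos h]; norm_num
  · rw [orderSign_of_gt (dartKey_lt_of_re_lt h), negIf_neg h.not_gt]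

theorem dartSign_self (d : G.Dart) : dartSign p d d = 0 := orderSign_self _

theorem dartSign_eq_of_fst_eq (hX : Function.Injective fun v => (p v).re) {d a g : G.Dart}
    (hdg : d.fst ≠ g.fst) (ha : a.fst = g.fst) : dartSign p d a = dartSign p d g := by
  have hne : (p d.fst).re ≠ (p g.fst).re := fun h => hdg (hX h)
  unfold dartSign
  rcases hne.lt_or_gt with h | h
  · rw [orderSign_of_lt (dartKey_lt_of_re_lt h),
      orderSign_of_lt (dartKey_lt_of_re_lt (by rw [ha]; exact h))]
  · rw [orderSign_of_gt (dartKey_lt_of_re_lt h),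
      orderSign_of_gt (dartKey_lt_of_re_lt (by rw [ha]; exact h))]

variable [Fintype V] [DecidableEq V] [DecidableRel G.Adj]

/-! ### Edge sets with prescribed parities -/

/-- The directed edges whose underlying edge is in `H`. -/
def dartsOf (G : SimpleGraph V) [DecidableRel G.Adj] (H : Finset (Sym2 V)) : Finset G.Dart :=
  Finset.univ.filter fun b => b.edge ∈ H

theorem mem_dartsOf {H : Finset (Sym2 V)} {b : G.Dart} : b ∈ dartsOf G H ↔ b.edge ∈ H := by
  simp [dartsOf]

theorem prod_dartsOf_fiber {M : Type*} [CommMonoid M] (H : Finset (Sym2 V)) (F : G.Dart → M)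
    {b : G.Dart} (hb : b.edge ∈ H) :
    ∏ c ∈ dartsOf G H with c.edge = b.edge, F c = F b * F b.symm := by
  have : (dartsOf G H).filter (fun c => c.edge = b.edge) = {b, b.symm} := by
    ext c
    simp only [Finset.mem_filter, mem_dartsOf, Finset.mem_insert, Finset.mem_singleton]
    rw [← SimpleGraph.dart_edge_eq_iff]
    exact ⟨fun h => h.2, fun h => ⟨h ▸ hb, h⟩⟩
  rw [this, Finset.prod_pair b.symm_ne.symm]

theorem prod_dartsOf_congr {M : Type*} [CommMonoid M] (H : Finset (Sym2 V)) {F F' : G.Dart → M}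
    (h : ∀ b : G.Dart, b.edge ∈ H → F b * F b.symm = F' b * F' b.symm) :
    ∏ b ∈ dartsOf G H, F b = ∏ b ∈ dartsOf G H, F' b := by
  rw [← Finset.prod_fiberwise_of_maps_to (t := H) (g := fun b : G.Dart => b.edge)
      fun b hb => mem_dartsOf.1 hb,
    ← Finset.prod_fiberwise_of_maps_to (t := H) (g := fun b : G.Dart => b.edge)
      fun b hb => mem_dartsOf.1 hb]
  refine Finset.prod_congr rfl fun f hf => ?_
  by_cases hex : ∃ b : G.Dart, b.edge = f
  · obtain ⟨b, rfl⟩ := hex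
    rw [prod_dartsOf_fiber H F hf, prod_dartsOf_fiber H F' hf, h b hf]
  · have : (dartsOf G H).filter (fun c => c.edge = f) = ∅ :=
      Finset.filter_eq_empty_iff.2 fun c _ hc => hex ⟨c, hc⟩
    rw [this, Finset.prod_empty, Finset.prod_empty]

theorem prod_dartsOf_erase {M : Type*} [CommMonoid M] {H : Finset (Sym2 V)} (F : G.Dart → M)
    {a : G.Dart} (ha : a.edge ∈ H) :
    ∏ b ∈ dartsOf G H, F b = F a * F a.symm * ∏ b ∈ dartsOf G (H.erase a.edge), F b := by
  have h1 : (dartsOf G H).filter (fun c => ¬c.edge = a.edge) = dartsOf G (H.erase a.edge) := by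
    ext c
    simp only [Finset.mem_filter, mem_dartsOf, Finset.mem_erase]
    exact and_comm
  rw [← Finset.prod_filter_mul_prod_filter_not _ (fun c : G.Dart => c.edge = a.edge),
    prod_dartsOf_fiber H F ha, h1]

/-- The degrees of the edge set `H` have the parity of `δ_v + δ_w`. In particular all of them are
even if `v = w`. The edges of `H` at `z` are counted by their directed versions with tail `z`. -/
def HasOddEnds (G : SimpleGraph V) [DecidableRel G.Adj] (H : Finset (Sym2 V)) (v w : V) : Prop :=
  ∀ z, ∏ b ∈ dartsOf G H, negIf (b.fst = z) = negIf (z = v) * negIf (z = w)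

/-- All degrees of the edge set `H` are even, see `HasOddEnds`. -/
def HasEvenDegrees (G : SimpleGraph V) [DecidableRel G.Adj] (H : Finset (Sym2 V)) : Prop :=
  ∀ z, ∏ b ∈ dartsOf G H, negIf (b.fst = z) = 1

theorem hasOddEnds_self_iff {H : Finset (Sym2 V)} {v : V} :
    HasOddEnds G H v v ↔ HasEvenDegrees G H := by
  simp only [HasOddEnds, HasEvenDegrees, negIf_mul_self]

theorem hasOddEnds_erase_iff {H : Finset (Sym2 V)} {v : V} {a : G.Dart} (ha : a.edge ∈ H) :
    HasOddEnds G (H.erase a.edge) v a.snd ↔ HasOddEnds G H v a.fst := by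
  refine forall_congr' fun z => ?_
  rw [prod_dartsOf_erase _ ha]
  have h1 : negIf (a.fst = z) = negIf (z = a.fst) := negIf_congr eq_comm
  have h2 : negIf (a.symm.fst = z) = negIf (z = a.snd) := negIf_congr eq_comm
  rw [h1, h2]
  have h3 := negIf_mul_self (z = a.fst)
  have h4 := negIf_mul_self (z = a.snd)
  constructor
  · intro h
    rw [h]
    linear_combination negIf (z = v) * negIf (z = a.fst) * h4
  · intro h
    linear_combination negIf (z = a.snd) * negIf (z = a.fst) * h + negIf (z = v) *
      negIf (z = a.snd) * h3 - (negIf (z = a.snd) * negIf (z = a.snd) *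
      ∏ b ∈ dartsOf G (H.erase a.edge), negIf (b.fst = z)) * h3 -
      (∏ b ∈ dartsOf G (H.erase a.edge), negIf (b.fst = z)) * h4

theorem HasOddEnds.prod_fst {H : Finset (Sym2 V)} {v w : V} (h : HasOddEnds G H v w)
    (P : V → Prop) : ∏ b ∈ dartsOf G H, negIf (P b.fst) = negIf (P v) * negIf (P w) := by
  classical
  have hsingle : ∀ v : V, negIf (P v) = ∏ z, if P z then negIf (z = v) else 1 := by
    intro v
    rw [Finset.prod_eq_single v]
    · by_cases hv : P v <;> simp [negIf, hv]
    · intro z _ hz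
      simp [negIf, hz]
    · simp
  have hb : ∀ b : G.Dart, negIf (P b.fst) = ∏ z, if P z then negIf (b.fst = z) else 1 := by
    intro b
    rw [hsingle]
    refine Finset.prod_congr rfl fun z _ => ?_
    rw [negIf_congr eq_comm]
  simp only [hb]
  rw [Finset.prod_comm, hsingle v, hsingle w, ← Finset.prod_mul_distrib]
  refine Finset.prod_congr rfl fun z _ => ?_
  by_cases hz : P z
  · simp only [hz, if_true]
    exact h z
  · simp [hz]

/-! ### The sign of a configuration -/

/-- The sign of the curve that starts at `d`, see `crossSign`, against the edge set `H`. -/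
noncomputable def totalCrossSign (p : V → ℂ) (H : Finset (Sym2 V)) (d : G.Dart) : ℤ :=
  ∏ b ∈ dartsOf G H, crossSign p d b

/-- The sign of the configuration that consists of the edge set `H` and of two half-edges, at the
tails of `d` and `g`. -/
noncomputable def configSign (p : V → ℂ) (H : Finset (Sym2 V)) (d g : G.Dart) : ℤ :=
  dartSign p d g * totalCrossSign p H d * totalCrossSign p H g

theorem totalCrossSign_erase {H : Finset (Sym2 V)} {a : G.Dart} (ha : a.edge ∈ H) (d : G.Dart) :
    totalCrossSign p H d =
      crossSign p d a * crossSign p d a.symm * totalCrossSign p (H.erase a.edge) d :=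
  prod_dartsOf_erase _ ha

theorem prod_negIf_mul_self {ι : Type*} (A : Finset ι) (P : ι → Prop) :
    (∏ b ∈ A, negIf (P b)) * ∏ b ∈ A, negIf (P b) = 1 := by
  rw [← Finset.prod_mul_distrib]
  exact Finset.prod_eq_one fun b _ => negIf_mul_self _

theorem totalCrossSign_mul_self (H : Finset (Sym2 V)) (d : G.Dart) :
    totalCrossSign p H d * totalCrossSign p H d = 1 := prod_negIf_mul_self _ _

/-- The curves of `a` and `-a` together bound the region below the edge of `a`, so the parity of
their crossings with `H` is determined by the odd vertices of `H` in that region. -/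
theorem totalCrossSign_mul_symm (hX : Function.Injective fun v => (p v).re)
    (hp : IsStraightLineEmbedding G p) {H : Finset (Sym2 V)} {a : G.Dart} {w : V}
    (ha : a.edge ∈ H) (h : HasOddEnds G H w a.fst) :
    totalCrossSign p H a * totalCrossSign p H a.symm = edgeSign p a * shadowSign p a w := by
  unfold totalCrossSign
  rw [← Finset.prod_mul_distrib]
  -- the edge of `a` is the only one where `crossSign_edge` fails, by a factor `-1`
  rw [prod_dartsOf_congr H (F' := fun b => shadowSign p a b.fst * negIf (b = a))]
  · rw [Finset.prod_mul_distrib, Finset.prod_eq_single a (f := fun b => negIf (b = a))]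
    · have h' : ∏ b ∈ dartsOf G H, shadowSign p a b.fst =
          shadowSign p a w * shadowSign p a a.fst := h.prod_fst (InShadow p a)
      rw [h', shadowSign_fst hX, negIf_pos rfl]
      ring
    · intro b _ hb
      exact negIf_neg hb
    · intro hna
      exact absurd (mem_dartsOf.2 ha) hna
  · intro b hb
    by_cases hba : b.edge = a.edge
    · have h1 : shadowSign p a a.fst * negIf (a = a) *
          (shadowSign p a a.symm.fst * negIf (a.symm = a)) = 1 := by
        have : a.symm.fst = a.snd := rfl
        rw [this, shadowSign_fst hX, shadowSign_snd hX, negIf_pos rfl, negIf_neg a.symm_ne]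
        linear_combination edgeSign_mul_self (p := p) a
      have h2 := crossSign_self_symm (p := p) a.symm
      rw [SimpleGraph.Dart.symm_symm] at h2
      rcases (SimpleGraph.dart_edge_eq_iff b a).1 hba with rfl | rfl
      · rw [crossSign_self, crossSign_self, crossSign_self_symm, h2, h1]
        norm_num
      · rw [SimpleGraph.Dart.symm_symm, crossSign_self, crossSign_self, crossSign_self_symm, h2,
          mul_comm (shadowSign p a _ * _), h1]
        norm_num
    · have hb1 : b ≠ a := fun e => hba (by rw [e])
      have hb2 : b.symm ≠ a := fun e => hba (by rw [← e, SimpleGraph.Dart.edge_symm])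
      have h := crossSign_edge hX hp hba
      rw [negIf_neg hb1, negIf_neg hb2, mul_one, mul_one]
      have : b.symm.fst = b.snd := rfl
      rw [this, ← h]
      ring

/-- Removing the edge of `a` from `H` and moving the half-edge at the tail of `a` to its head. -/
theorem edgeSign_mul_configSign_erase (hX : Function.Injective fun v => (p v).re)
    (hp : IsStraightLineEmbedding G p) {H : Finset (Sym2 V)} {d a : G.Dart}
    (ha : a.edge ∈ H) (hd : d.edge ∉ H) (h : HasOddEnds G H d.fst a.fst) :
    edgeSign p a * configSign p (H.erase a.edge) d a.symm = configSign p H d a := by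
  have h1 := totalCrossSign_mul_symm hX hp ha h
  have h2 := totalCrossSign_erase (p := p) ha d
  have h3 := totalCrossSign_erase (p := p) ha a.symm
  have h4 := crossSign_self_symm (p := p) a.symm
  rw [SimpleGraph.Dart.symm_symm] at h4
  rw [h4, crossSign_self, one_mul, one_mul] at h3
  have h5 := dartSign_symm_mul hX hp (d := d) (a := a) fun e => hd (e ▸ ha)
  have h6 := totalCrossSign_mul_self (p := p) H a
  have h7 := edgeSign_mul_self (p := p) a
  have h8 : crossSign p d a * crossSign p d a = 1 := negIf_mul_self _
  have h9 : crossSign p d a.symm * crossSign p d a.symm = 1 := negIf_mul_self _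
  have h10 : totalCrossSign p (H.erase a.edge) d =
      crossSign p d a * crossSign p d a.symm * totalCrossSign p H d := by
    rw [h2]
    linear_combination -(crossSign p d a.symm * crossSign p d a.symm *
      totalCrossSign p (H.erase a.edge) d) * h8 - totalCrossSign p (H.erase a.edge) d * h9
  have h11 : totalCrossSign p H a.symm =
      edgeSign p a * shadowSign p a d.fst * totalCrossSign p H a := by
    rw [← h1]
    linear_combination -totalCrossSign p H a.symm * h6
  unfold configSign
  rw [h10, ← h3, h11, ← h5]
  linear_combination (dartSign p d a.symm * crossSign p d a * crossSign p d a.symm *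
    totalCrossSign p H d * shadowSign p a d.fst * totalCrossSign p H a) * h7

/-- Removing an edge from an even set leaves a configuration with half-edges at its two ends. -/
theorem edgeSign_mul_configSign_erase_self (hX : Function.Injective fun v => (p v).re)
    (hp : IsStraightLineEmbedding G p) {H : Finset (Sym2 V)} {d : G.Dart}
    (hd : d.edge ∈ H) (h : HasOddEnds G H d.fst d.fst) :
    edgeSign p d * configSign p (H.erase d.edge) d d.symm = 1 := by
  have h1 := totalCrossSign_mul_symm hX hp hd h
  have h2 := totalCrossSign_erase (p := p) hd d
  have h3 := totalCrossSign_erase (p := p) hd d.symm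
  have h4 := crossSign_self_symm (p := p) d.symm
  rw [SimpleGraph.Dart.symm_symm] at h4
  rw [h4, crossSign_self, one_mul, one_mul] at h3
  rw [crossSign_self_symm, crossSign_self, one_mul, one_mul] at h2
  have h7 := edgeSign_mul_self (p := p) d
  unfold configSign
  rw [← h2, ← h3, mul_assoc, h1, dartSign_symm_right hX, shadowSign_fst hX]
  linear_combination (edgeSign p d * edgeSign p d + 1) * h7

/-- The sign `τ(d, g)` if `d` and `g` have the same tail, and zero otherwise. -/
noncomputable def localSign (p : V → ℂ) (d g : G.Dart) : ℤ :=
  if d.fst = g.fst then dartSign p d g else 0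

/-- For the directed edges with tail `v`, the crossing signs differ only in the turning part of the
curves. -/
theorem exists_totalCrossSign_eq (p : V → ℂ) (H : Finset (Sym2 V)) (v : V) :
    ∃ N : ℤ, N * N = 1 ∧ ∀ a : G.Dart, a.fst = v → totalCrossSign p H a =
      N * ∏ b ∈ (dartsOf G H).filter (fun b => b.fst = v), negIf (dartKey p b < dartKey p a) := by
  refine ⟨∏ b ∈ dartsOf G H, negIf ((p b.fst).re < (p v).re ∧ (p v).re < (p b.snd).re ∧
    lineAt p b.fst b.snd (p v).re < (p v).im), prod_negIf_mul_self _ _, ?_⟩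
  rintro a rfl
  unfold totalCrossSign
  rw [Finset.prod_filter, ← Finset.prod_mul_distrib]
  refine Finset.prod_congr rfl fun b _ => ?_
  unfold crossSign
  by_cases hb : b.fst = a.fst
  · rw [hb, if_pos rfl]
    simp [negIf]
  · simp [hb]

/-- The expansion of the sign of a configuration at the tail of `g`. Up to factors that do not
depend on `a`, it is the Pfaffian expansion `sum_alternating_of_odd`, for the directed edges of `H`
at this vertex, together with `d` if `d` has the same tail. -/
theorem localSign_sub_sum_configSign (hX : Function.Injective fun v => (p v).re)
    (hp : IsStraightLineEmbedding G p) {H : Finset (Sym2 V)} {d g : G.Dart}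
    (hd : d.edge ∉ H) (h : HasOddEnds G H d.fst g.fst) :
    localSign p d g - ∑ a ∈ dartsOf G H, configSign p H d a * localSign p a g =
      if g.edge ∈ H then 0 else configSign p H d g := by
  obtain ⟨N, hN, hcross⟩ := exists_totalCrossSign_eq (G := G) p H g.fst
  set A := (dartsOf G H).filter (fun b => b.fst = g.fst) with hA
  have hmemA : ∀ a, a ∈ A ↔ a.edge ∈ H ∧ a.fst = g.fst := fun a => by
    rw [hA, Finset.mem_filter, mem_dartsOf]
  have hgA : g ∈ A ↔ g.edge ∈ H := by simp [hmemA]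
  have hdA : d ∉ A := fun hm => hd ((hmemA d).1 hm).1
  have hcard : (-1 : ℤ) ^ A.card = -negIf (g.fst = d.fst) := by
    have := h g.fst
    rw [negIf_pos rfl, mul_neg_one] at this
    rw [← Finset.prod_const, hA, Finset.prod_filter, ← this]
    refine Finset.prod_congr rfl fun b _ => ?_
    by_cases hb : b.fst = g.fst <;> simp [negIf, hb]
  have hsum : ∑ a ∈ dartsOf G H, configSign p H d a * localSign p a g =
      ∑ a ∈ A, configSign p H d a * dartSign p a g := by
    rw [hA, Finset.sum_filter]
    refine Finset.sum_congr rfl fun a _ => ?_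
    simp [localSign]
  rw [hsum]
  have hkey := dartKey_injective hX hp
  by_cases hdg : d.fst = g.fst
  · have hodd : (-1 : ℤ) ^ (insert d A).card = -1 := by
      rw [Finset.card_insert_of_notMem hdA, pow_succ, hcard, negIf_pos hdg.symm]
      norm_num
    have hkd := sum_alternating_of_odd hkey hodd g
    rw [Finset.sum_insert hdA, Finset.prod_insert hdA, Finset.prod_insert hdA,
      negIf_neg (lt_irrefl _), one_mul] at hkd
    set D := ∏ b ∈ A, negIf (dartKey p b < dartKey p d) with hD
    have hDD : D * D = 1 := prod_negIf_mul_self _ _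
    have hs : ∀ a : G.Dart, a.fst = g.fst → configSign p H d a =
        D * (dartSign p d a * ∏ b ∈ A, negIf (dartKey p b < dartKey p a)) := by
      intro a ha
      rw [configSign, hcross d hdg, hcross a ha, ← hD]
      linear_combination dartSign p d a * D *
        (∏ b ∈ A, negIf (dartKey p b < dartKey p a)) * hN
    have hsum2 : ∑ a ∈ A, (∏ b ∈ insert d A, negIf (dartKey p b < dartKey p a)) *
        orderSign (dartKey p a) (dartKey p g) =
        -∑ a ∈ A, (dartSign p d a * ∏ b ∈ A, negIf (dartKey p b < dartKey p a)) *
          dartSign p a g := by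
      rw [← Finset.sum_neg_distrib]
      refine Finset.sum_congr rfl fun a ha => ?_
      have hda : dartKey p d ≠ dartKey p a := fun e => hdA (hkey e ▸ ha)
      rw [Finset.prod_insert hdA, dartSign, orderSign_eq_neg_negIf hda, dartSign]
      ring
    have hsum3 : ∑ a ∈ A, configSign p H d a * dartSign p a g =
        D * ∑ a ∈ A, (dartSign p d a * ∏ b ∈ A, negIf (dartKey p b < dartKey p a)) *
          dartSign p a g := by
      rw [Finset.mul_sum]
      refine Finset.sum_congr rfl fun a ha => ?_
      rw [hs a ((hmemA a).1 ha).2, mul_assoc]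
    rw [hsum2] at hkd
    rw [hsum3, localSign, if_pos hdg, hs g rfl]
    change D * dartSign p d g + -_ = _ at hkd
    by_cases hg : g.edge ∈ H
    · rw [if_pos (by simp [hgA, hg])] at hkd
      rw [if_pos hg]
      linear_combination D * hkd - dartSign p d g * hDD
    · by_cases hgd : g = d
      · subst hgd
        rw [if_pos (by simp)] at hkd
        rw [if_neg hg]
        rw [dartSign_self] at hkd ⊢
        linear_combination D * hkd
      · have hgd' : dartKey p d ≠ dartKey p g := fun e => hgd (hkey e).symm
        rw [if_neg (by simp [hgA, hg, hgd])] at hkd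
        rw [if_neg hg]
        have : dartSign p d g = -negIf (dartKey p d < dartKey p g) := orderSign_eq_neg_negIf hgd'
        linear_combination D * hkd - dartSign p d g * hDD -
          D * (∏ b ∈ A, negIf (dartKey p b < dartKey p g)) * this
  · rw [negIf_neg (Ne.symm hdg)] at hcard
    have hkd := sum_alternating_of_odd hkey hcard g
    have hs : ∀ a : G.Dart, a.fst = g.fst → configSign p H d a = dartSign p d g *
        totalCrossSign p H d * N * ∏ b ∈ A, negIf (dartKey p b < dartKey p a) := by
      intro a ha
      rw [configSign, hcross a ha, dartSign_eq_of_fst_eq hX hdg ha]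
      ring
    have hsum2 : ∑ a ∈ A, configSign p H d a * dartSign p a g =
        dartSign p d g * totalCrossSign p H d * N *
          ∑ a ∈ A, (∏ b ∈ A, negIf (dartKey p b < dartKey p a)) *
            orderSign (dartKey p a) (dartKey p g) := by
      rw [Finset.mul_sum]
      refine Finset.sum_congr rfl fun a ha => ?_
      rw [hs a ((hmemA a).1 ha).2, mul_assoc]
      rfl
    rw [hsum2, hkd, localSign, if_neg hdg, hs g rfl]
    simp only [hgA]
    split_ifs <;> ring

variable {R : Type*} [CommRing R]

/-! ### The inverse of the real form of the transition matrix -/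

open Classical in
/-- The generating function of the even subgraphs, with weights in any commutative ring. -/
noncomputable def evenSum (G : SimpleGraph V) [DecidableRel G.Adj] (x : Sym2 V → R) : R :=
  ∑ H ∈ G.edgeFinset.powerset, if HasEvenDegrees G H then ∏ e ∈ H, x e else 0

open Classical in
/-- The signed generating function of the edge sets that become even when one half-edge is added
at the tail of `d` and one at the tail of `g`. -/
noncomputable def oddSum (p : V → ℂ) (x : Sym2 V → R) (d g : G.Dart) : R :=
  ∑ H ∈ G.edgeFinset.powerset,
    if HasOddEnds G H d.fst g.fst ∧ d.edge ∉ H ∧ g.edge ∉ H then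
      (configSign p H d g : R) * ∏ e ∈ H, x e
    else 0

theorem sum_powerset_erase {M ι : Type*} [AddCommMonoid M] [DecidableEq ι] {E : Finset ι} {e : ι}
    (he : e ∈ E) (f : Finset ι → M) :
    ∑ H ∈ E.powerset, (if e ∈ H then f (H.erase e) else 0) =
      ∑ H ∈ E.powerset, if e ∉ H then f H else 0 := by
  rw [← Finset.sum_filter, ← Finset.sum_filter]
  refine Finset.sum_nbij' (fun H => H.erase e) (fun H => insert e H) ?_ ?_ ?_ ?_ ?_
  · intro H hH
    simp only [Finset.mem_filter, Finset.mem_powerset] at hH ⊢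
    exact ⟨(Finset.erase_subset _ _).trans hH.1, Finset.notMem_erase _ _⟩
  · intro H hH
    simp only [Finset.mem_filter, Finset.mem_powerset] at hH ⊢
    exact ⟨Finset.insert_subset he hH.1, Finset.mem_insert_self _ _⟩
  · intro H hH
    exact Finset.insert_erase (Finset.mem_filter.1 hH).2
  · intro H hH
    exact Finset.erase_insert (Finset.mem_filter.1 hH).2
  · intro H _
    rfl

omit [DecidableEq V] in
theorem edge_mem_edgeFinset (a : G.Dart) : a.edge ∈ G.edgeFinset :=
  SimpleGraph.mem_edgeFinset.2 a.edge_mem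

open Classical in
/-- The products `oddSum p x d (-a) * ε(a) * x_a` collect the edge sets that contain the edge of
`a`, with the half-edge moved back from the head of `a` to its tail. -/
theorem oddSum_symm_mul (hX : Function.Injective fun v => (p v).re)
    (hp : IsStraightLineEmbedding G p) (x : Sym2 V → R) {d a : G.Dart} (had : a ≠ d) :
    oddSum p x d a.symm * ((edgeSign p a : R) * x a.edge) =
      ∑ H ∈ G.edgeFinset.powerset,
        if HasOddEnds G H d.fst a.fst ∧ d.edge ∉ H ∧ a.edge ∈ H then
          (configSign p H d a : R) * ∏ e ∈ H, x e
        else 0 := by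
  by_cases hda : a.symm = d
  · have h0 : ∀ H, configSign p H d a.symm = 0 := fun H => by
      rw [hda, configSign, dartSign_self, zero_mul, zero_mul]
    have he : d.edge = a.edge := by rw [← hda, SimpleGraph.Dart.edge_symm]
    unfold oddSum
    rw [Finset.sum_eq_zero, zero_mul, Finset.sum_eq_zero]
    · intro H _
      rw [if_neg]
      rintro ⟨-, h1, h2⟩
      exact h1 (he ▸ h2)
    · intro H _
      simp [h0]
  · have hne : d.edge ≠ a.edge := fun h => by
      rcases (SimpleGraph.dart_edge_eq_iff d a).1 h with h | h
      · exact had h.symm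
      · exact hda h.symm
    unfold oddSum
    rw [Finset.sum_mul]
    have := sum_powerset_erase (edge_mem_edgeFinset a) fun H =>
      if HasOddEnds G H d.fst a.snd ∧ d.edge ∉ H then
        (configSign p H d a.symm : R) * (∏ e ∈ H, x e) * ((edgeSign p a : R) * x a.edge)
      else 0
    calc _ = _ := ?_
      _ = _ := this.symm
      _ = _ := ?_
    · refine Finset.sum_congr rfl fun H _ => ?_
      rw [SimpleGraph.Dart.edge_symm]
      have : a.symm.fst = a.snd := rfl
      rw [this]
      by_cases h1 : a.edge ∈ H <;> by_cases h2 : HasOddEnds G H d.fst a.snd <;>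
        by_cases h3 : d.edge ∈ H <;> simp [h1, h2, h3]
    · refine Finset.sum_congr rfl fun H _ => ?_
      by_cases h1 : a.edge ∈ H
      · have h4 : d.edge ∉ H.erase a.edge ↔ d.edge ∉ H := by simp [hne]
        rw [if_pos h1, hasOddEnds_erase_iff h1]
        by_cases h2 : HasOddEnds G H d.fst a.fst ∧ d.edge ∉ H
        · rw [if_pos ⟨h2.1, h4.2 h2.2⟩, if_pos ⟨h2.1, h2.2, h1⟩, ← Finset.mul_prod_erase H x h1,
            ← edgeSign_mul_configSign_erase hX hp h1 h2.2 h2.1]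
          push_cast
          ring
        · rw [if_neg fun h => h2 ⟨h.1, h4.1 h.2⟩, if_neg fun h => h2 ⟨h.1, h.2.1⟩]
      · rw [if_neg h1, if_neg fun h => h1 h.2.2]

open Classical in
theorem oddSum_symm_self_mul (hX : Function.Injective fun v => (p v).re)
    (hp : IsStraightLineEmbedding G p) (x : Sym2 V → R) (d : G.Dart) :
    oddSum p x d d.symm * ((edgeSign p d : R) * x d.edge) =
      ∑ H ∈ G.edgeFinset.powerset,
        if HasEvenDegrees G H ∧ d.edge ∈ H then ∏ e ∈ H, x e else 0 := by
  unfold oddSum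
  rw [Finset.sum_mul]
  have := sum_powerset_erase (edge_mem_edgeFinset d) fun H =>
    if HasOddEnds G H d.fst d.snd then
      (configSign p H d d.symm : R) * (∏ e ∈ H, x e) * ((edgeSign p d : R) * x d.edge)
    else 0
  calc _ = _ := ?_
    _ = _ := this.symm
    _ = _ := ?_
  · refine Finset.sum_congr rfl fun H _ => ?_
    rw [SimpleGraph.Dart.edge_symm]
    have : d.symm.fst = d.snd := rfl
    rw [this]
    by_cases h1 : d.edge ∈ H <;> by_cases h2 : HasOddEnds G H d.fst d.snd <;> simp [h1, h2]
  · refine Finset.sum_congr rfl fun H _ => ?_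
    by_cases h1 : d.edge ∈ H
    · rw [if_pos h1, hasOddEnds_erase_iff h1, hasOddEnds_self_iff]
      by_cases h2 : HasEvenDegrees G H
      · have := congrArg (Int.cast (R := R))
          (edgeSign_mul_configSign_erase_self hX hp h1 (hasOddEnds_self_iff.2 h2))
        push_cast at this
        rw [if_pos h2, if_pos ⟨h2, h1⟩, ← Finset.mul_prod_erase H x h1]
        linear_combination (x d.edge * ∏ e ∈ H.erase d.edge, x e) * this
      · rw [if_neg h2, if_neg fun h => h2 h.1]
    · rw [if_neg h1, if_neg fun h => h1 h.2]

open Classical in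
theorem evenSum_update_zero (x : Sym2 V → R) (d : G.Dart) :
    evenSum G (Function.update x d.edge 0) =
      ∑ H ∈ G.edgeFinset.powerset,
        if HasEvenDegrees G H ∧ d.edge ∉ H then ∏ e ∈ H, x e else 0 := by
  refine Finset.sum_congr rfl fun H _ => ?_
  by_cases h1 : d.edge ∈ H
  · rw [Finset.prod_eq_zero h1 (by simp)]
    simp [h1]
  · have : ∏ e ∈ H, Function.update x d.edge 0 e = ∏ e ∈ H, x e :=
      Finset.prod_congr rfl fun e he => Function.update_of_ne (fun h => h1 (by rwa [← h])) _ _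
    simp [h1, this]

theorem evenSum_eq_add (hX : Function.Injective fun v => (p v).re)
    (hp : IsStraightLineEmbedding G p) (x : Sym2 V → R) (d : G.Dart) :
    evenSum G x = evenSum G (Function.update x d.edge 0) +
      oddSum p x d d.symm * ((edgeSign p d : R) * x d.edge) := by
  classical
  rw [oddSum_symm_self_mul hX hp, evenSum_update_zero, ← Finset.sum_add_distrib]
  refine Finset.sum_congr rfl fun H _ => ?_
  by_cases h1 : d.edge ∈ H <;> by_cases h2 : HasEvenDegrees G H <;> simp [h1, h2]

/-- The equation of the Green's function, summed from `localSign_sub_sum_configSign`. -/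
theorem oddSum_eq (hX : Function.Injective fun v => (p v).re)
    (hp : IsStraightLineEmbedding G p) (x : Sym2 V → R) (d g : G.Dart) :
    oddSum p x d g = evenSum G x * (localSign p d g : R) -
      ∑ a : G.Dart, oddSum p x d a.symm * ((edgeSign p a : R) * x a.edge) *
        (localSign p a g : R) := by
  classical
  rw [← Finset.add_sum_erase _ _ (Finset.mem_univ d), evenSum_eq_add hX hp x d]
  have h1 : ∀ a ∈ Finset.univ.erase d,
      oddSum p x d a.symm * ((edgeSign p a : R) * x a.edge) * (localSign p a g : R) =
      ∑ H ∈ G.edgeFinset.powerset,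
        if HasOddEnds G H d.fst g.fst ∧ d.edge ∉ H ∧ a.edge ∈ H then
          ((configSign p H d a * localSign p a g : ℤ) : R) * ∏ e ∈ H, x e
        else 0 := by
    intro a ha
    rw [oddSum_symm_mul hX hp x (Finset.ne_of_mem_erase ha), Finset.sum_mul]
    refine Finset.sum_congr rfl fun H _ => ?_
    by_cases hag : a.fst = g.fst
    · rw [hag]
      split_ifs
      · push_cast
        ring
      · rw [zero_mul]
    · simp [localSign, hag]
  rw [Finset.sum_congr rfl h1]
  have h2 : ∑ a ∈ Finset.univ.erase d, ∑ H ∈ G.edgeFinset.powerset,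
        (if HasOddEnds G H d.fst g.fst ∧ d.edge ∉ H ∧ a.edge ∈ H then
          ((configSign p H d a * localSign p a g : ℤ) : R) * ∏ e ∈ H, x e
        else 0) = ∑ H ∈ G.edgeFinset.powerset,
      if HasOddEnds G H d.fst g.fst ∧ d.edge ∉ H then
        ((∑ a ∈ dartsOf G H, configSign p H d a * localSign p a g : ℤ) : R) * ∏ e ∈ H, x e
      else 0 := by
    rw [Finset.sum_erase]
    · rw [Finset.sum_comm]
      refine Finset.sum_congr rfl fun H _ => ?_
      by_cases hH : HasOddEnds G H d.fst g.fst ∧ d.edge ∉ H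
      · rw [if_pos hH]
        push_cast
        rw [Finset.sum_mul, dartsOf, Finset.sum_filter]
        refine Finset.sum_congr rfl fun a _ => ?_
        simp [hH.1, hH.2]
      · rw [if_neg hH]
        refine Finset.sum_eq_zero fun a _ => ?_
        rw [if_neg fun h => hH ⟨h.1, h.2.1⟩]
    · refine Finset.sum_eq_zero fun H _ => ?_
      rw [if_neg fun h => h.2.1 h.2.2]
  have h3 : evenSum G (Function.update x d.edge 0) * (localSign p d g : R) =
      ∑ H ∈ G.edgeFinset.powerset, if HasOddEnds G H d.fst g.fst ∧ d.edge ∉ H then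
        (localSign p d g : R) * ∏ e ∈ H, x e else 0 := by
    rw [evenSum_update_zero, Finset.sum_mul]
    refine Finset.sum_congr rfl fun H _ => ?_
    by_cases hdg : d.fst = g.fst
    · rw [← hdg, hasOddEnds_self_iff, ite_mul, zero_mul, mul_comm]
    · simp [localSign, hdg]
  have h4 : oddSum p x d g = evenSum G (Function.update x d.edge 0) * (localSign p d g : R) -
      ∑ H ∈ G.edgeFinset.powerset,
      if HasOddEnds G H d.fst g.fst ∧ d.edge ∉ H then
        ((∑ a ∈ dartsOf G H, configSign p H d a * localSign p a g : ℤ) : R) * ∏ e ∈ H, x e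
      else 0 := by
    rw [h3, ← Finset.sum_sub_distrib]
    refine Finset.sum_congr rfl fun H _ => ?_
    by_cases hH : HasOddEnds G H d.fst g.fst ∧ d.edge ∉ H
    · have := congrArg (Int.cast (R := R)) (localSign_sub_sum_configSign hX hp hH.2 hH.1)
      rw [if_pos hH, if_pos hH, ← sub_mul, ← Int.cast_sub, this]
      by_cases hg : g.edge ∈ H <;> simp [hg, hH.1, hH.2]
    · rw [if_neg hH, if_neg hH, if_neg fun h => hH ⟨h.1, h.2.1⟩, sub_zero]
  rw [h2, h4]
  ring

/-- The transition matrix in a gauge in which all its entries are signs times weights. -/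
noncomputable def signMatrix (p : V → ℂ) (x : Sym2 V → R) : Matrix G.Dart G.Dart R :=
  Matrix.of fun f g => (edgeSign p f : R) * x f.edge * (localSign p f.symm g : R)

/-- The row at `e` of the inverse of `1 - signMatrix p x`, multiplied by `evenSum G x`. -/
noncomputable def greenRow (p : V → ℂ) (x : Sym2 V → R) (e : G.Dart) : G.Dart → R :=
  fun g => evenSum G x * (1 : Matrix G.Dart G.Dart R) e g +
    (edgeSign p e : R) * x e.edge * oddSum p x e.symm g

theorem greenRow_vecMul (hX : Function.Injective fun v => (p v).re)
    (hp : IsStraightLineEmbedding G p) (x : Sym2 V → R) (e : G.Dart) :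
    Matrix.vecMul (greenRow p x e) (1 - signMatrix p x) =
      evenSum G x • (1 : Matrix G.Dart G.Dart R) e := by
  have hsum : ∀ g, ∑ f, oddSum p x e.symm f * signMatrix p x f g =
      oddSum p x e.symm g - evenSum G x * (localSign p e.symm g : R) := by
    intro g
    have := oddSum_eq hX hp x e.symm g
    rw [← Equiv.sum_comp (Function.Involutive.toPerm _ SimpleGraph.Dart.symm_involutive)]
    rw [this, sub_right_comm, sub_self, zero_sub, ← Finset.sum_neg_distrib]
    refine Finset.sum_congr rfl fun a _ => ?_
    simp only [Function.Involutive.coe_toPerm, signMatrix, Matrix.of_apply,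
      SimpleGraph.Dart.edge_symm, SimpleGraph.Dart.symm_symm, edgeSign_symm hX]
    push_cast
    ring
  have hone : ∀ g, ∑ f, (1 : Matrix G.Dart G.Dart R) e f * signMatrix p x f g =
      signMatrix p x e g := fun g => by
    rw [← Matrix.mul_apply, Matrix.one_mul]
  funext g
  rw [Matrix.vecMul_sub, Matrix.vecMul_one, Pi.sub_apply, Pi.smul_apply, smul_eq_mul]
  have : Matrix.vecMul (greenRow p x e) (signMatrix p x) g =
      evenSum G x * signMatrix p x e g + (edgeSign p e : R) * x e.edge *
        (oddSum p x e.symm g - evenSum G x * (localSign p e.symm g : R)) := by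
    rw [← hsum, ← hone g, Finset.mul_sum, Finset.mul_sum, ← Finset.sum_add_distrib]
    refine Finset.sum_congr rfl fun f _ => ?_
    unfold greenRow
    ring
  rw [this, greenRow, signMatrix, Matrix.of_apply]
  ring

theorem greenRow_self (hX : Function.Injective fun v => (p v).re)
    (hp : IsStraightLineEmbedding G p) (x : Sym2 V → R) (e : G.Dart) :
    greenRow p x e e = evenSum G (Function.update x e.edge 0) := by
  have h := evenSum_eq_add hX hp x e.symm
  rw [SimpleGraph.Dart.symm_symm, SimpleGraph.Dart.edge_symm, edgeSign_symm hX] at h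
  rw [greenRow, Matrix.one_apply_eq, mul_one]
  push_cast at h
  linear_combination h

theorem oddSum_self (x : Sym2 V → R) (d : G.Dart) : oddSum p x d d = 0 := by
  refine Finset.sum_eq_zero fun H _ => ?_
  simp [configSign, dartSign_self]

theorem greenRow_symm (x : Sym2 V → R) (e : G.Dart) : greenRow p x e e.symm = 0 := by
  rw [greenRow, oddSum_self, Matrix.one_apply_ne e.symm_ne.symm]
  ring

/-! ### The determinant -/

theorem det_updateRow_one {n : Type*} [Fintype n] [DecidableEq n] (i : n) (w : n → R) :
    ((1 : Matrix n n R).updateRow i w).det = w i := by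
  rw [← Matrix.cramer_transpose_apply, Matrix.transpose_one, Matrix.cramer_one]
  rfl

theorem det_updateRow_updateRow_one {n : Type*} [Fintype n] [DecidableEq n] {i j : n}
    (hij : i ≠ j) {v w : n → R} (hv : v j = 0) :
    (((1 : Matrix n n R).updateRow i v).updateRow j w).det = v i * w j := by
  have : ((1 : Matrix n n R).updateRow i v).updateRow j w =
      (1 : Matrix n n R).updateRow i v * (1 : Matrix n n R).updateRow j w := by
    have hmul : ∀ (u : n → R) (l : n), ∑ k, u k * (1 : Matrix n n R).updateRow j w k l =
        u l + u j * (w l - (1 : Matrix n n R) j l) := by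
      intro u l
      have : ∀ k, u k * (1 : Matrix n n R).updateRow j w k l =
          u k * (1 : Matrix n n R) k l +
            if k = j then u j * (w l - (1 : Matrix n n R) j l) else 0 := by
        intro k
        by_cases hk : k = j
        · subst hk
          simp
          ring
        · simp [hk]
      simp only [this, Finset.sum_add_distrib, Finset.sum_ite_eq', Finset.mem_univ, if_true]
      simp [Matrix.one_apply]
    ext k l
    rw [Matrix.mul_apply, hmul]
    by_cases hk : k = j
    · subst hk
      simp [Matrix.updateRow_ne hij.symm]
    · rw [Matrix.updateRow_ne hk]
      by_cases hki : k = i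
      · subst hki
        simp [hv]
      · simp [Matrix.updateRow_ne hki, Matrix.one_apply_ne hk]
  rw [this, Matrix.det_mul, det_updateRow_one, det_updateRow_one]

/-- Multiplying `1 - signMatrix p x` from the left by the identity with the rows at `d` and `-d`
replaced by those of `greenRow` clears these two rows, as does setting the weight of `d` to zero. -/
theorem det_mul_evenSum_sq (hX : Function.Injective fun v => (p v).re)
    (hp : IsStraightLineEmbedding G p) (x : Sym2 V → R) (d : G.Dart) :
    evenSum G (Function.update x d.edge 0) ^ 2 * (1 - signMatrix (G := G) p x).det =
      evenSum G x ^ 2 * (1 - signMatrix (G := G) p (Function.update x d.edge 0)).det := by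
  set W := ((1 : Matrix G.Dart G.Dart R).updateRow d (greenRow p x d)).updateRow d.symm
    (greenRow p x d.symm) with hW
  have hd : d ≠ d.symm := d.symm_ne.symm
  have hWdet : W.det = evenSum G (Function.update x d.edge 0) ^ 2 := by
    rw [hW, det_updateRow_updateRow_one hd (greenRow_symm x d), greenRow_self hX hp,
      greenRow_self hX hp, SimpleGraph.Dart.edge_symm, sq]
  set D : G.Dart → R := fun b => if b = d ∨ b = d.symm then evenSum G x else 1 with hD
  have hDdet : (Matrix.diagonal D).det = evenSum G x ^ 2 := by
    rw [Matrix.det_diagonal, hD, Finset.prod_ite, Finset.prod_const_one, mul_one,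
      Finset.prod_const]
    have : Finset.univ.filter (fun b => b = d ∨ b = d.symm) = {d, d.symm} := by
      ext b
      simp
    rw [this, Finset.card_pair hd]
  rw [← hWdet, ← hDdet, ← Matrix.det_mul, ← Matrix.det_mul]
  congr 1
  ext b g
  have hedge : b.edge = d.edge ↔ b = d ∨ b = d.symm := SimpleGraph.dart_edge_eq_iff b d
  rw [Matrix.diagonal_mul, Matrix.mul_apply_eq_vecMul]
  by_cases hb : b = d ∨ b = d.symm
  · have hrow : W b = greenRow p x b := by
      rcases hb with rfl | rfl
      · rw [hW, Matrix.updateRow_ne hd, Matrix.updateRow_self]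
      · rw [hW, Matrix.updateRow_self]
    rw [hrow, greenRow_vecMul hX hp]
    simp [hD, hb, signMatrix, hedge.2 hb]
  · have hrow : W b = (1 : Matrix G.Dart G.Dart R) b := by
      rw [hW, Matrix.updateRow_ne (fun h => hb (Or.inr h)),
        Matrix.updateRow_ne (fun h => hb (Or.inl h))]
    have hx : Function.update x d.edge 0 b.edge = x b.edge :=
      Function.update_of_ne (fun h => hb (hedge.1 h)) _ _
    rw [hrow, ← Matrix.mul_apply_eq_vecMul, Matrix.one_mul]
    simp [hD, hb, signMatrix, hx]

theorem evenSum_zero : evenSum G (0 : Sym2 V → R) = 1 := by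
  classical
  unfold evenSum
  rw [Finset.sum_eq_single ∅]
  · simp [HasEvenDegrees, dartsOf]
  · intro H _ hH
    obtain ⟨e, he⟩ := Finset.nonempty_iff_ne_empty.2 hH
    rw [Finset.prod_eq_zero he rfl, ite_self]
  · simp

theorem evenSum_congr {x y : Sym2 V → R} (h : ∀ e ∈ G.edgeSet, x e = y e) :
    evenSum G x = evenSum G y := by
  refine Finset.sum_congr rfl fun H hH => ?_
  congr 1
  exact Finset.prod_congr rfl fun e he =>
    h e (SimpleGraph.mem_edgeFinset.1 (Finset.mem_powerset.1 hH he))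

omit [Fintype V] [DecidableRel G.Adj] in
theorem signMatrix_congr {x y : Sym2 V → R} (h : ∀ e ∈ G.edgeSet, x e = y e) :
    signMatrix (G := G) p x = signMatrix p y := by
  ext f g
  simp [signMatrix, h f.edge f.edge_mem]

/-- The determinant formula, by adding the edges one at a time. -/
theorem det_one_sub_signMatrix_of_ne_zero [IsDomain R] (hX : Function.Injective fun v => (p v).re)
    (hp : IsStraightLineEmbedding G p) (x : Sym2 V → R)
    (hx : ∀ E : Finset (Sym2 V), evenSum G (fun e => if e ∈ E then x e else 0) ≠ 0) :
    (1 - signMatrix (G := G) p x).det = evenSum G x ^ 2 := by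
  suffices h : ∀ E : Finset (Sym2 V),
      (1 - signMatrix (G := G) p fun e => if e ∈ E then x e else 0).det =
        evenSum G (fun e => if e ∈ E then x e else 0) ^ 2 by
    simpa using h Finset.univ
  intro E
  induction E using Finset.induction_on with
  | empty =>
    have h0 : (fun e => if e ∈ (∅ : Finset (Sym2 V)) then x e else 0) = 0 := by
      funext e
      simp
    have h1 : signMatrix (G := G) p (0 : Sym2 V → R) = 0 := by
      ext f g
      simp [signMatrix]
    rw [h0, h1, evenSum_zero]
    simp
  | insert e E he ih =>
    by_cases hedge : e ∈ G.edgeSet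
    · obtain ⟨d, rfl⟩ : ∃ d : G.Dart, d.edge = e := by
        induction e using Sym2.ind with
        | _ a b => exact ⟨⟨(a, b), hedge⟩, rfl⟩
      have hupd : Function.update (fun e => if e ∈ insert d.edge E then x e else 0) d.edge 0 =
          fun e => if e ∈ E then x e else 0 := by
        funext e
        by_cases h : e = d.edge
        · subst h
          simp [he]
        · simp [h]
      have := det_mul_evenSum_sq hX hp (fun e => if e ∈ insert d.edge E then x e else 0) d
      rw [hupd, ih, mul_comm] at this
      exact mul_right_cancel₀ (pow_ne_zero 2 (hx E)) this
    · have hcongr : ∀ f ∈ G.edgeSet, (if f ∈ insert e E then x f else 0) =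
          if f ∈ E then x f else 0 := by
        intro f hf
        have : f ≠ e := fun h => hedge (h ▸ hf)
        simp [this]
      rw [signMatrix_congr hcongr, evenSum_congr hcongr, ih]

theorem map_evenSum {S : Type*} [CommRing S] (φ : R →+* S) (x : Sym2 V → R) :
    φ (evenSum G x) = evenSum G fun e => φ (x e) := by
  classical
  unfold evenSum
  rw [map_sum]
  refine Finset.sum_congr rfl fun H _ => ?_
  split_ifs
  · rw [map_prod]
  · rw [map_zero]

omit [Fintype V] [DecidableRel G.Adj] in
theorem map_signMatrix {S : Type*} [CommRing S] (φ : R →+* S) (x : Sym2 V → R) :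
    (signMatrix (G := G) p x).map φ = signMatrix p fun e => φ (x e) := by
  ext f g
  simp [signMatrix]

theorem det_one_sub_signMatrix [IsDomain R] (hX : Function.Injective fun v => (p v).re)
    (hp : IsStraightLineEmbedding G p) (x : Sym2 V → R) :
    (1 - signMatrix (G := G) p x).det = evenSum G x ^ 2 := by
  -- scaled by an indeterminate, all generating functions have constant coefficient one
  have h := det_one_sub_signMatrix_of_ne_zero (R := Polynomial R) hX hp
    (fun e => Polynomial.C (x e) * Polynomial.X) fun E h0 => by
      have := congrArg (Polynomial.evalRingHom 0) h0
      rw [map_evenSum, map_zero] at this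
      have hz : (fun e => Polynomial.evalRingHom (0 : R)
          (if e ∈ E then Polynomial.C (x e) * Polynomial.X else 0)) = 0 := by
        funext e
        split_ifs <;> simp
      rw [hz, evenSum_zero] at this
      exact one_ne_zero this
  have h1 := congrArg (Polynomial.evalRingHom 1) h
  have h2 : (fun e => Polynomial.evalRingHom (1 : R) (Polynomial.C (x e) * Polynomial.X)) = x := by
    funext e
    simp
  rw [map_pow, map_evenSum, RingHom.map_det, map_sub, map_one, RingHom.mapMatrix_apply,
    map_signMatrix, h2] at h1
  exact h1

end

section

variable {V : Type*} {G : SimpleGraph V} {p : V → ℂ}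

/-! ### The gauge -/

theorem abs_arg_lt_of_re_pos {z : ℂ} (hz : 0 < z.re) : |z.arg| < Real.pi / 2 :=
  Complex.abs_arg_lt_pi_div_two_iff.2 (Or.inl hz)

theorem arg_div_of_re_pos {z w : ℂ} (hz : 0 < z.re) (hw : 0 < w.re) :
    (w / z).arg = w.arg - z.arg := by
  have h1 := abs_lt.1 (abs_arg_lt_of_re_pos hz)
  have h2 := abs_lt.1 (abs_arg_lt_of_re_pos hw)
  have hz0 : z ≠ 0 := fun h => by simp [h] at hz
  have hw0 : w ≠ 0 := fun h => by simp [h] at hw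
  have hinv : (z⁻¹).arg = -z.arg := by
    rw [Complex.arg_inv, if_neg]
    intro h
    linarith [Real.pi_pos]
  rw [div_eq_mul_inv, Complex.arg_mul hw0 (inv_ne_zero hz0), hinv, sub_eq_add_neg]
  rw [hinv]
  constructor <;> linarith

theorem arg_neg_div_of_arg_lt {z w : ℂ} (hz : 0 < z.re) (hw : 0 < w.re) (h : z.arg < w.arg) :
    (-(w / z)).arg = w.arg - z.arg - Real.pi := by
  have h1 := abs_lt.1 (abs_arg_lt_of_re_pos hz)
  have h2 := abs_lt.1 (abs_arg_lt_of_re_pos hw)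
  have h3 := arg_div_of_re_pos hz hw
  rw [← h3, Complex.arg_neg_eq_arg_sub_pi_of_im_pos]
  refine lt_of_le_of_ne (Complex.arg_nonneg_iff.1 (by linarith)) fun h0 => ?_
  rcases le_or_gt 0 (w / z).re with hre | hre
  · have := Complex.arg_eq_zero_iff.2 ⟨hre, h0.symm⟩
    linarith
  · have := Complex.arg_eq_pi_iff.2 ⟨hre, h0.symm⟩
    linarith

theorem arg_neg_div_of_lt_arg {z w : ℂ} (hz : 0 < z.re) (hw : 0 < w.re) (h : w.arg < z.arg) :
    (-(w / z)).arg = w.arg - z.arg + Real.pi := by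
  rw [← arg_div_of_re_pos hz hw, Complex.arg_neg_eq_arg_add_pi_of_im_neg]
  refine Complex.arg_neg_iff.1 ?_
  rw [arg_div_of_re_pos hz hw]
  linarith

theorem arg_lt_arg_iff_of_re_pos {z w : ℂ} (hz : 0 < z.re) (hw : 0 < w.re) :
    z.arg < w.arg ↔ z.im / z.re < w.im / w.re := by
  have h1 := abs_lt.1 (abs_arg_lt_of_re_pos hz)
  have h2 := abs_lt.1 (abs_arg_lt_of_re_pos hw)
  rw [← Complex.tan_arg, ← Complex.tan_arg]
  exact (Real.strictMonoOn_tan.lt_iff_lt ⟨by linarith, h1.2⟩ ⟨by linarith, h2.2⟩).symm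

open Classical in
/-- The exponential of `I / 2` times the direction of `d`, where the direction angle is taken in
`(-π / 2, π / 2)` if `d` points to the right, and in `(π / 2, 3 * π / 2)` if it points to the
left. -/
noncomputable def halfPhase (p : V → ℂ) (d : G.Dart) : ℂ :=
  if (p d.fst).re < (p d.snd).re then
    Complex.exp (Complex.I / 2 * ((p d.snd - p d.fst).arg : ℂ))
  else Complex.I * Complex.exp (Complex.I / 2 * ((p d.fst - p d.snd).arg : ℂ))

theorem halfPhase_of_right {d : G.Dart} (h : (p d.fst).re < (p d.snd).re) :
    halfPhase p d = Complex.exp (Complex.I / 2 * ((p d.snd - p d.fst).arg : ℂ)) := if_pos h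

theorem halfPhase_of_left {d : G.Dart} (h : (p d.snd).re < (p d.fst).re) :
    halfPhase p d =
      Complex.I * Complex.exp (Complex.I / 2 * ((p d.fst - p d.snd).arg : ℂ)) :=
  if_neg h.not_gt

theorem halfPhase_ne_zero (d : G.Dart) : halfPhase p d ≠ 0 := by
  unfold halfPhase
  split_ifs
  · exact Complex.exp_ne_zero _
  · exact mul_ne_zero Complex.I_ne_zero (Complex.exp_ne_zero _)

theorem exp_half_sub_pi (t : ℝ) : Complex.exp (Complex.I / 2 * ((t - Real.pi : ℝ) : ℂ)) =
    -Complex.I * Complex.exp (Complex.I / 2 * (t : ℂ)) := by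
  have : Complex.I / 2 * ((t - Real.pi : ℝ) : ℂ) =
      Complex.I / 2 * (t : ℂ) + -(Real.pi / 2 * Complex.I) := by
    push_cast
    ring
  rw [this, Complex.exp_add, Complex.exp_neg, Complex.exp_pi_div_two_mul_I, Complex.inv_I]
  ring

theorem exp_half_add_pi (t : ℝ) : Complex.exp (Complex.I / 2 * ((t + Real.pi : ℝ) : ℂ)) =
    Complex.I * Complex.exp (Complex.I / 2 * (t : ℂ)) := by
  have : Complex.I / 2 * ((t + Real.pi : ℝ) : ℂ) =
      Complex.I / 2 * (t : ℂ) + (Real.pi / 2 * Complex.I) := by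
    push_cast
    ring
  rw [this, Complex.exp_add, Complex.exp_pi_div_two_mul_I]
  ring

theorem exp_half_sub (s t : ℝ) : Complex.exp (Complex.I / 2 * ((t - s : ℝ) : ℂ)) =
    (Complex.exp (Complex.I / 2 * (s : ℂ)))⁻¹ * Complex.exp (Complex.I / 2 * (t : ℂ)) := by
  rw [← Complex.exp_neg, ← Complex.exp_add]
  congr 1
  push_cast
  ring

/-- The half-angle weight is a square root of the quotient of two directions, and so is
`halfPhase p g / halfPhase p f`. The sign between them is found by comparing slopes. -/
theorem exp_half_turningAngle [DecidableEq V] (hX : Function.Injective fun v => (p v).re)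
    (hp : IsStraightLineEmbedding G p) {f g : G.Dart} (hfg : f.snd = g.fst) (hne : g ≠ f.symm) :
    Complex.exp (Complex.I / 2 * (turningAngle p f g : ℂ)) =
      (halfPhase p f)⁻¹ * ((edgeSign p f * localSign p f.symm g : ℤ) : ℂ) * halfPhase p g := by
  have hloc : localSign p f.symm g = dartSign p f.symm g := if_pos hfg
  have hkey : dartKey p f.symm ≠ dartKey p g := fun h => hne (dartKey_injective hX hp h).symm
  rw [hloc, dartSign]
  unfold turningAngle
  rcases (re_fst_ne_re_snd hX f).lt_or_gt with hf | hf <;>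
    rcases (re_fst_ne_re_snd hX g).lt_or_gt with hg | hg
  · have hf' : 0 < (p f.snd - p f.fst).re := by simpa using hf
    have hg' : 0 < (p g.snd - p g.fst).re := by simpa using hg
    have hlt := dartKey_lt_of_right_of_left (p := p) (d := g) (g := f.symm) hfg.symm hg hf
    rw [orderSign_of_gt hlt, edgeSign, negIf_pos hf, halfPhase_of_right hf, halfPhase_of_right hg,
      arg_div_of_re_pos hf' hg', exp_half_sub]
    norm_num
  · have hf' : 0 < (p f.snd - p f.fst).re := by simpa using hf
    have hg' : 0 < (p g.fst - p g.snd).re := by simpa using hg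
    have hdiv : (p g.snd - p g.fst) / (p f.snd - p f.fst) =
        -((p g.fst - p g.snd) / (p f.snd - p f.fst)) := by
      rw [← neg_div, neg_sub]
    have hlt : dartKey p f.symm < dartKey p g →
        (p f.snd - p f.fst).arg < (p g.fst - p g.snd).arg := by
      rw [dartKey_lt_iff_of_left (d := f.symm) hfg hf hg, arg_lt_arg_iff_of_re_pos hf' hg',
        lineSlope_comm g.fst, lineSlope_comm f.symm.fst]
      exact id
    have hgt : dartKey p g < dartKey p f.symm →
        (p g.fst - p g.snd).arg < (p f.snd - p f.fst).arg := by
      rw [dartKey_lt_iff_of_left (g := f.symm) hfg.symm hg hf, arg_lt_arg_iff_of_re_pos hg' hf',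
        lineSlope_comm g.fst, lineSlope_comm f.symm.fst]
      exact id
    rw [hdiv, edgeSign, negIf_pos hf, halfPhase_of_right hf, halfPhase_of_left hg]
    rcases hkey.lt_or_gt with h | h
    · rw [orderSign_of_lt h, arg_neg_div_of_arg_lt hf' hg' (hlt h), exp_half_sub_pi,
        exp_half_sub]
      push_cast
      ring
    · rw [orderSign_of_gt h, arg_neg_div_of_lt_arg hf' hg' (hgt h), exp_half_add_pi, exp_half_sub]
      push_cast
      ring
  · have hf' : 0 < (p f.fst - p f.snd).re := by simpa using hf
    have hg' : 0 < (p g.snd - p g.fst).re := by simpa using hg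
    have hdiv : (p g.snd - p g.fst) / (p f.snd - p f.fst) =
        -((p g.snd - p g.fst) / (p f.fst - p f.snd)) := by
      rw [← div_neg, neg_sub]
    have hlt : dartKey p f.symm < dartKey p g →
        (p f.fst - p f.snd).arg < (p g.snd - p g.fst).arg := by
      rw [dartKey_lt_iff_of_right (d := f.symm) hfg hf hg, arg_lt_arg_iff_of_re_pos hf' hg']
      exact id
    have hgt : dartKey p g < dartKey p f.symm →
        (p g.snd - p g.fst).arg < (p f.fst - p f.snd).arg := by
      rw [dartKey_lt_iff_of_right (g := f.symm) hfg.symm hg hf, arg_lt_arg_iff_of_re_pos hg' hf']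
      exact id
    rw [hdiv, edgeSign, negIf_neg hf.not_gt, halfPhase_of_left hf, halfPhase_of_right hg, mul_inv,
      Complex.inv_I]
    rcases hkey.lt_or_gt with h | h
    · rw [orderSign_of_lt h, arg_neg_div_of_arg_lt hf' hg' (hlt h), exp_half_sub_pi,
        exp_half_sub]
      push_cast
      ring
    · rw [orderSign_of_gt h, arg_neg_div_of_lt_arg hf' hg' (hgt h), exp_half_add_pi, exp_half_sub]
      push_cast
      ring
  · have hf' : 0 < (p f.fst - p f.snd).re := by simpa using hf
    have hg' : 0 < (p g.fst - p g.snd).re := by simpa using hg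
    have hdiv : (p g.snd - p g.fst) / (p f.snd - p f.fst) =
        (p g.fst - p g.snd) / (p f.fst - p f.snd) := by
      rw [← neg_div_neg_eq, neg_sub, neg_sub]
    have hlt := dartKey_lt_of_right_of_left (p := p) (d := f.symm) (g := g) hfg hf hg
    rw [hdiv, orderSign_of_lt hlt, edgeSign, negIf_neg hf.not_gt, halfPhase_of_left hf,
      halfPhase_of_left hg, arg_div_of_re_pos hf' hg', exp_half_sub]
    rw [mul_inv, Complex.inv_I]
    push_cast
    linear_combination ((Complex.exp (Complex.I / 2 * ((p f.fst - p f.snd).arg : ℂ)))⁻¹ *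
      Complex.exp (Complex.I / 2 * ((p g.fst - p g.snd).arg : ℂ))) * Complex.I_mul_I

/-! ### Reduction to distinct abscissas -/

theorem mul_mem_openSegment {a b z : ℂ} (c : ℂ) (h : z ∈ openSegment ℝ a b) :
    c * z ∈ openSegment ℝ (c * a) (c * b) := by
  obtain ⟨s, t, hs, ht, hst, rfl⟩ := h
  refine ⟨s, t, hs, ht, hst, ?_⟩
  simp only [Complex.real_smul]
  ring

theorem IsStraightLineEmbedding.const_mul (hp : IsStraightLineEmbedding G p) {c : ℂ}
    (hc : c ≠ 0) : IsStraightLineEmbedding G fun v => c * p v := by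
  have hmem : ∀ {a b z : ℂ}, z ∈ openSegment ℝ (c * a) (c * b) → c⁻¹ * z ∈ openSegment ℝ a b := by
    intro a b z h
    simpa [inv_mul_cancel_left₀ hc] using mul_mem_openSegment c⁻¹ h
  refine ⟨fun v w h => hp.injective (mul_left_cancel₀ hc h), fun a b v hab h => ?_,
    fun a b a' b' hab hab' hne => Set.disjoint_left.2 fun z h h' => ?_⟩
  · refine hp.vertex_notMem a b v hab ?_
    simpa [inv_mul_cancel_left₀ hc] using hmem h
  · exact Set.disjoint_left.1 (hp.edges_disjoint a b a' b' hab hab' hne) (hmem h) (hmem h')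

theorem exists_injective_re_mul [Finite V] (hp : Function.Injective p) :
    ∃ c : ℂ, c ≠ 0 ∧ Function.Injective fun v => (c * p v).re := by
  have := Fintype.ofFinite V
  classical
  obtain ⟨t, ht⟩ := Infinite.exists_notMem_finset (Finset.univ.image fun vw : V × V =>
    ((p vw.1).re - (p vw.2).re) / ((p vw.1).im - (p vw.2).im))
  refine ⟨⟨1, t⟩, fun h => by simpa using congrArg Complex.re h, fun v w h => ?_⟩
  simp only [Complex.mul_re, one_mul] at h
  by_cases him : (p v).im = (p w).im
  · refine hp (Complex.ext ?_ him)
    rw [him] at h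
    linarith
  · refine absurd (Finset.mem_image.2 ⟨(v, w), Finset.mem_univ _, ?_⟩) ht
    have : (p v).im - (p w).im ≠ 0 := sub_ne_zero.2 him
    field_simp
    linarith

variable [Fintype V] [DecidableEq V] [DecidableRel G.Adj]

/-! ### The transition matrix and the even subgraphs -/

theorem transitionMatrix_eq (hX : Function.Injective fun v => (p v).re)
    (hp : IsStraightLineEmbedding G p) (x : Sym2 V → ℝ) :
    transitionMatrix (G := G) p x = Matrix.diagonal (fun d => (halfPhase p d)⁻¹) *
      signMatrix p (fun e => (x e : ℂ)) * Matrix.diagonal (halfPhase p) := by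
  ext f g
  rw [Matrix.mul_diagonal, Matrix.diagonal_mul, transitionMatrix, signMatrix, Matrix.of_apply,
    Matrix.of_apply]
  by_cases hfg : f.snd = g.fst
  · by_cases hne : g = f.symm
    · subst hne
      simp [localSign, dartSign_self]
    · rw [if_pos ⟨hfg, hne⟩, exp_half_turningAngle hX hp hfg hne]
      push_cast
      ring
  · have : localSign p f.symm g = 0 := if_neg hfg
    simp [hfg, this]

theorem det_one_sub_transitionMatrix (hX : Function.Injective fun v => (p v).re)
    (hp : IsStraightLineEmbedding G p) (x : Sym2 V → ℝ) :
    (1 - transitionMatrix (G := G) p x).det = evenSum G (fun e => (x e : ℂ)) ^ 2 := by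
  have hone : (1 : Matrix G.Dart G.Dart ℂ) =
      Matrix.diagonal (fun d => (halfPhase p d)⁻¹) * 1 * Matrix.diagonal (halfPhase p) := by
    rw [Matrix.mul_one, Matrix.diagonal_mul_diagonal, ← Matrix.diagonal_one]
    congr 1
    funext d
    exact (inv_mul_cancel₀ (halfPhase_ne_zero d)).symm
  have hmul : 1 - transitionMatrix (G := G) p x = Matrix.diagonal (fun d => (halfPhase p d)⁻¹) *
      (1 - signMatrix p (fun e => (x e : ℂ))) * Matrix.diagonal (halfPhase p) := by
    rw [Matrix.mul_sub, Matrix.sub_mul, ← hone, transitionMatrix_eq hX hp]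
  rw [hmul, Matrix.det_mul_right_comm, Matrix.diagonal_mul_diagonal, Matrix.det_mul,
    ← det_one_sub_signMatrix hX hp, Matrix.det_diagonal]
  rw [Finset.prod_eq_one fun d _ => inv_mul_cancel₀ (halfPhase_ne_zero d), one_mul]

theorem prod_dartsOf_negIf_fst {H : Finset (Sym2 V)} (hH : H ⊆ G.edgeFinset) (v : V) :
    ∏ b ∈ dartsOf G H, negIf (b.fst = v) = (-1) ^ (H.filter fun e => v ∈ e).card := by
  rw [← Finset.prod_const, Finset.prod_filter,
    ← Finset.prod_fiberwise_of_maps_to (t := H) (g := fun b : G.Dart => b.edge)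
      fun b hb => mem_dartsOf.1 hb]
  refine Finset.prod_congr rfl fun e he => ?_
  have hedge : e ∈ G.edgeSet := SimpleGraph.mem_edgeFinset.1 (hH he)
  obtain ⟨d, rfl⟩ : ∃ d : G.Dart, d.edge = e := by
    induction e using Sym2.ind with
    | _ a b => exact ⟨⟨(a, b), hedge⟩, rfl⟩
  rw [prod_dartsOf_fiber H _ he]
  have h1 : d.symm.fst = d.snd := rfl
  have h2 : v ∈ d.edge ↔ d.fst = v ∨ d.snd = v := by
    rw [SimpleGraph.Dart.edge, Sym2.mem_iff, eq_comm, eq_comm (a := v)]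
  have hadj := d.adj.ne
  rw [h1]
  by_cases hv : d.fst = v
  · have hv' : d.snd ≠ v := fun h => hadj (hv.trans h.symm)
    rw [negIf_pos hv, negIf_neg hv', if_pos (h2.2 (Or.inl hv))]
    norm_num
  · by_cases hv' : d.snd = v
    · rw [negIf_neg hv, negIf_pos hv', if_pos (h2.2 (Or.inr hv'))]
      norm_num
    · rw [negIf_neg hv, negIf_neg hv', if_neg fun h => (h2.1 h).elim hv hv']
      norm_num

theorem hasEvenDegrees_iff {H : Finset (Sym2 V)} (hH : H ⊆ G.edgeFinset) :
    HasEvenDegrees G H ↔ IsEven H := by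
  refine forall_congr' fun v => ?_
  rw [prod_dartsOf_negIf_fst hH, neg_one_pow_eq_one_iff_even (by norm_num)]

theorem evenSum_eq_evenGeneratingFunction (x : Sym2 V → ℝ) :
    evenSum G (fun e => (x e : ℂ)) = (evenGeneratingFunction G x : ℂ) := by
  classical
  unfold evenSum evenGeneratingFunction
  rw [Finset.sum_filter]
  push_cast
  refine Finset.sum_congr rfl fun H hH => ?_
  have := hasEvenDegrees_iff (Finset.mem_powerset.1 hH)
  by_cases h : IsEven H
  · rw [if_pos (this.2 h), if_pos h]
    push_cast
    rfl
  · rw [if_neg (mt this.1 h), if_neg h]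
    simp

end

end KacWard

theorem theorem1 {V : Type*} [Fintype V] [DecidableEq V] (G : SimpleGraph V) [DecidableRel G.Adj]
    (p : V → ℂ) (hp : KacWard.IsStraightLineEmbedding G p) (x : Sym2 V → ℝ) :
    (1 - KacWard.transitionMatrix (G := G) p x).det =
      (KacWard.evenGeneratingFunction G x : ℂ) ^ 2 := by
  obtain ⟨c, hc, hX⟩ := KacWard.exists_injective_re_mul hp.injective
  have hrot : KacWard.transitionMatrix (G := G) p x =
      KacWard.transitionMatrix (fun v => c * p v) x := by
    ext e g
    simp only [KacWard.transitionMatrix, KacWard.turningAngle, ← mul_sub, mul_div_mul_left _ _ hc]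
  rw [hrot, KacWard.det_one_sub_transitionMatrix hX (hp.const_mul hc),
    KacWard.evenSum_eq_evenGeneratingFunction]
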